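/- All quantum systems are finite-dimensional. Let $\mathcal{N}_{A_1\cdots A_K\to C}$ be a quantum channel (completely positive, trace-preserving linear map) with $K$ senders and one receiver, let $\theta_{S_kA_k}$, $k\in[K]=\{1,\dots,K\}$, be quantum states, and let $$\omega_{S_1\cdots S_KC}=\mathcal{N}_{A_1\cdots A_K\to C}(\theta_{S_1A_1}\otimes\cdots\otimes\theta_{S_KA_K}).$$ For $\mathcal{J}\subseteq[K]$ write $S(\mathcal J)$ for the systems $S_j$, $j\in\mathcal J$, and put $$\tilde I(S(\mathcal J);CS(\mathcal J^c))_\omega = H_2(S(\mathcal J^c)C)_\omega-H(S(\mathcal J^c)C\,|\,S(\mathcal J))_\omega,$$ where $H_2(B)_\rho=-\log_2\operatorname{Tr}\{\rho_B^2\}$ is the Rényi entropy of order two, $H(B)_\rho=-\operatorname{Tr}\{\rho_B\log_2\rho_B\}$ and $H(B|D)_\rho=H(BD)_\rho-H(D)_\rho$. If real numbers $R_1,\dots,R_K$ satisfy $$\sum_{j\in\mathcal J}R_j\le\tilde I(S(\mathcal J);CS(\mathcal J^c))_\omega\qquad\text{for every non-empty }\mathcal J\subseteq[K],$$ then the rate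 tuple $(R_1,\dots,R_K)$ is achievable for entanglement-assisted classical communication over $\mathcal N$ by employing a quantum simultaneous decoder, in the following sense. An entanglement-assisted code with message sizes $M_1,\dots,M_K$ for a channel $\Phi_{B_1\cdots B_K\to D}$ consists of states $\Psi^{(k)}_{R_kA'_k}$ (sender $k$ holds $A'_k$, the receiver holds $R_1,\dots,R_K$), encoding channels $\mathcal E^{(k),m}_{A'_k\to B_k}$ for $1\le m\le M_k$, and a POVM $\{\Lambda^{m_1,\dots,m_K}_{R_1\cdots R_KD}\}$; its average error probability is $$\frac1{M_1\cdots M_K}\sum_{m_1,\dots,m_K}\operatorname{Tr}\Big\{(I-\Lambda^{m_1,\dots,m_K})\,\Phi\Big(\bigotimes_{k=1}^K\mathcal E^{(k),m_k}(\Psi^{(k)}_{R_kA'_k})\Big)\Big\}.$$ The code employs a (position-based) quantum simultaneous decoder if each $R_k$ consists of $M_k$ copies $Q_k^{(1)},\dots,Q_k^{(M_k)}$ of some system $Q_k$ and, for some test operator $0\le T_{Q_1\cdots Q_KD}\le I$, $$\Lambda^{m}=\Big(\sum_{m'}\Gamma^{m'}\Big)^{-1/2}\Gamma^{m}\Big(\sum_{m'}\Gamma^{m'}\Big)^{-1/2},\qquad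 m=(m_1,\dots,m_K),$$ where $\Gamma^{m}$ is $T$ acting on $Q_1^{(m_1)},\dots,Q_K^{(m_K)}$ and $D$, tensored with the identity on the remaining registers. Achievability means: for all $\varepsilon\in(0,1)$ and $\delta>0$ and all sufficiently large $n$, there is an entanglement-assisted code for $\mathcal N^{\otimes n}$ (sender $k$ feeding $A_k^n$) with $M_k=\lceil2^{n(R_k-\delta)}\rceil$ for every $k$ and average error probability at most $\varepsilon$ that employs a quantum simultaneous decoder. -/

import Mathlib

/-! Quantum systems are finite-dimensional: the Hilbert space of a system with index type `ι` is
`ℂ^ι`, operators on it are the matrices `Matrix ι ι ℂ`, and the composite of `ι` and `κ` is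
`ι × κ` (respectively `∀ k, ι k` for a family of systems). -/

namespace QMAC

open scoped ComplexOrder

noncomputable section

/-- A quantum state (density operator). -/
def IsState {ι : Type} [Fintype ι] (ρ : Matrix ι ι ℂ) : Prop :=
  ρ.PosSemidef ∧ ρ.trace = 1

/-- `id_R ⊗ Φ` for a linear map `Φ` on operators. -/
def ampliate {R A B : Type} (Φ : Matrix A A ℂ →ₗ[ℂ] Matrix B B ℂ)
    (X : Matrix (R × A) (R × A) ℂ) : Matrix (R × B) (R × B) ℂ :=
  fun p q => Φ (fun a a' => X (p.1, a) (q.1, a')) p.2 q.2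

/-- A quantum channel: a completely positive trace-preserving linear map. -/
structure IsChannel {A B : Type} [Fintype A] [Fintype B]
    (Φ : Matrix A A ℂ →ₗ[ℂ] Matrix B B ℂ) : Prop where
  completelyPositive : ∀ (R : Type) [Fintype R] (X : Matrix (R × A) (R × A) ℂ),
    X.PosSemidef → (ampliate Φ X).PosSemidef
  tracePreserving : ∀ X : Matrix A A ℂ, (Φ X).trace = X.trace

/-- The tensor product `⨂ₖ X k` of operators on `R k ⊗ A k`, with the `R` systems collected to the
left and the `A` systems to the right. -/
def tensorPairs {K : ℕ} {R A : Fin K → Type}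
    (X : ∀ k, Matrix (R k × A k) (R k × A k) ℂ) :
    Matrix ((∀ k, R k) × (∀ k, A k)) ((∀ k, R k) × (∀ k, A k)) ℂ :=
  fun p q => ∏ k, X k (p.1 k, p.2 k) (q.1 k, q.2 k)

/-- The memoryless channel `N^{⊗n}` of a `K`-sender channel `N`; the input of sender `k` is the
block `A k ^ n`. It sends the matrix unit `|a⟩⟨a'|` to `⨂ᵢ N(|aᵢ⟩⟨a'ᵢ|)`. -/
def tensorPower {K : ℕ} {A : Fin K → Type} {C : Type}
    [∀ k, Fintype (A k)] [∀ k, DecidableEq (A k)]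
    (N : Matrix (∀ k, A k) (∀ k, A k) ℂ →ₗ[ℂ] Matrix C C ℂ) (n : ℕ) :
    Matrix (∀ k, Fin n → A k) (∀ k, Fin n → A k) ℂ →ₗ[ℂ] Matrix (Fin n → C) (Fin n → C) ℂ where
  toFun X := Matrix.of fun c c' => ∑ a, ∑ a', X a a' *
    ∏ i, N (Matrix.single (fun k => a k i) (fun k => a' k i) 1) (c i) (c' i)
  map_add' X Y := by
    ext c c'
    simp only [Matrix.add_apply, Matrix.of_apply, add_mul, Finset.sum_add_distrib]
  map_smul' z X := by
    ext c c'
    simp only [Matrix.smul_apply, Matrix.of_apply, smul_eq_mul, mul_assoc, Finset.mul_sum,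
      RingHom.id_apply]

/-- The von Neumann entropy `H(ρ) = -∑ λ log₂ λ` over the eigenvalues of `ρ` (with `0 log 0 = 0`);
only meaningful for Hermitian `ρ`. -/
def entropy {ι : Type} [Fintype ι] [DecidableEq ι] (ρ : Matrix ι ι ℂ) : ℝ :=
  open Classical in
  if h : ρ.IsHermitian then ∑ i, Real.negMulLog (h.eigenvalues i) / Real.log 2 else 0

/-- The Rényi entropy of order two, `H₂(ρ) = -log₂ Tr ρ²`. -/
def renyiTwo {ι : Type} [Fintype ι] (ρ : Matrix ι ι ℂ) : ℝ :=
  -Real.logb 2 (ρ * ρ).trace.re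

/-- The marginal on `S(J) C` of an operator on `S₁ ⋯ S_K C`. -/
def marginalSC {K : ℕ} {S : Fin K → Type} {C : Type} [∀ k, Fintype (S k)]
    (ω : Matrix ((∀ k, S k) × C) ((∀ k, S k) × C) ℂ) (J : Finset (Fin K)) :
    Matrix ((∀ k : {k // k ∈ J}, S k) × C) ((∀ k : {k // k ∈ J}, S k) × C) ℂ :=
  fun p q => ∑ t : (∀ k : {k // k ∉ J}, S k),
    ω ((Equiv.piEquivPiSubtypeProd (fun k => k ∈ J) S).symm (p.1, t), p.2)
      ((Equiv.piEquivPiSubtypeProd (fun k => k ∈ J) S).symm (q.1, t), q.2)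

/-- The marginal on `S(J)` of an operator on `S₁ ⋯ S_K C`. -/
def marginalS {K : ℕ} {S : Fin K → Type} {C : Type} [∀ k, Fintype (S k)] [Fintype C]
    (ω : Matrix ((∀ k, S k) × C) ((∀ k, S k) × C) ℂ) (J : Finset (Fin K)) :
    Matrix (∀ k : {k // k ∈ J}, S k) (∀ k : {k // k ∈ J}, S k) ℂ :=
  fun s s' => ∑ c, marginalSC ω J (s, c) (s', c)

/-- The conditional entropy `H(S(Jᶜ) C | S(J)) = H(S₁ ⋯ S_K C) - H(S(J))`. -/
def condEntropy {K : ℕ} {S : Fin K → Type} {C : Type} [∀ k, Fintype (S k)]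
    [∀ k, DecidableEq (S k)] [Fintype C] [DecidableEq C]
    (ω : Matrix ((∀ k, S k) × C) ((∀ k, S k) × C) ℂ) (J : Finset (Fin K)) : ℝ :=
  entropy ω - entropy (marginalS ω J)

/-- `Ĩ(S(J); C S(Jᶜ)) = H₂(S(Jᶜ) C) - H(S(Jᶜ) C | S(J))`. -/
def rateBound {K : ℕ} {S : Fin K → Type} {C : Type} [∀ k, Fintype (S k)]
    [∀ k, DecidableEq (S k)] [Fintype C] [DecidableEq C]
    (ω : Matrix ((∀ k, S k) × C) ((∀ k, S k) × C) ℂ) (J : Finset (Fin K)) : ℝ :=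
  renyiTwo (marginalSC ω Jᶜ) - condEntropy ω J

/-- An entanglement-assisted classical code for `K` senders with channel inputs `B k`, for a
channel with output `D`: sender `k` shares a state on `R k ⊗ A' k` with the receiver, who holds
`R k`, and encodes a message from a set of size `M k` by a channel `A' k → B k`; the receiver
measures all of the `R k` and the channel output with a POVM whose outcomes are the message
tuples. -/
structure EACode {K : ℕ} (M : Fin K → ℕ) (R A' B : Fin K → Type) (D : Type)
    [∀ k, Fintype (R k)] [∀ k, DecidableEq (R k)] [∀ k, Fintype (A' k)]
    [∀ k, Fintype (B k)] [Fintype D] [DecidableEq D] where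
  shared : ∀ k, Matrix (R k × A' k) (R k × A' k) ℂ
  shared_isState : ∀ k, IsState (shared k)
  enc : ∀ k, Fin (M k) → (Matrix (A' k) (A' k) ℂ →ₗ[ℂ] Matrix (B k) (B k) ℂ)
  enc_isChannel : ∀ k m, IsChannel (enc k m)
  dec : (∀ k, Fin (M k)) → Matrix ((∀ k, R k) × D) ((∀ k, R k) × D) ℂ
  dec_posSemidef : ∀ m, (dec m).PosSemidef
  dec_sum : ∑ m, dec m = 1

section Code

variable {K : ℕ} {M : Fin K → ℕ} {R A' B : Fin K → Type} {D : Type}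
  [∀ k, Fintype (R k)] [∀ k, DecidableEq (R k)] [∀ k, Fintype (A' k)]
  [∀ k, Fintype (B k)] [Fintype D] [DecidableEq D]

/-- The receiver's state when the message tuple `m` is sent over the channel `Φ`. -/
def EACode.received (c : EACode M R A' B D)
    (Φ : Matrix (∀ k, B k) (∀ k, B k) ℂ →ₗ[ℂ] Matrix D D ℂ) (m : ∀ k, Fin (M k)) :
    Matrix ((∀ k, R k) × D) ((∀ k, R k) × D) ℂ :=
  ampliate Φ (tensorPairs fun k => ampliate (c.enc k (m k)) (c.shared k))

/-- The error probability `Tr{(I - Λ^m) ρ^m}` for the message tuple `m`. -/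
def EACode.errorProb (c : EACode M R A' B D)
    (Φ : Matrix (∀ k, B k) (∀ k, B k) ℂ →ₗ[ℂ] Matrix D D ℂ) (m : ∀ k, Fin (M k)) : ℝ :=
  ((1 - c.dec m) * c.received Φ m).trace.re

/-- The average error probability. -/
def EACode.avgError (c : EACode M R A' B D)
    (Φ : Matrix (∀ k, B k) (∀ k, B k) ℂ →ₗ[ℂ] Matrix D D ℂ) : ℝ :=
  (∑ m, c.errorProb Φ m) / ∏ k, (M k : ℝ)

end Code

section Decoder

variable {K : ℕ} {M : Fin K → ℕ} {Q : Fin K → Type} {D : Type}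
  [∀ k, Fintype (Q k)] [∀ k, DecidableEq (Q k)] [Fintype D] [DecidableEq D]

/-- The receiver holds `M k` registers of type `Q k` for each sender `k`. `checkOp T m` is the
operator `T` acting on the registers number `m 1, …, m K` and on the channel output `D`, tensored
with the identity on all other registers. -/
def checkOp (T : Matrix ((∀ k, Q k) × D) ((∀ k, Q k) × D) ℂ) (m : ∀ k, Fin (M k)) :
    Matrix ((∀ k, Fin (M k) → Q k) × D) ((∀ k, Fin (M k) → Q k) × D) ℂ :=
  fun p q =>
    if ∀ k, ∀ i, i ≠ m k → p.1 k i = q.1 k i then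
      T (fun k => p.1 k (m k), p.2) (fun k => q.1 k (m k), q.2)
    else 0

/-- The square-root measurement `(∑ Γ^{m'})^{-1/2} Γ^m (∑ Γ^{m'})^{-1/2}` with
`Γ^m = checkOp T m`; the power `-1/2` is taken on the support. -/
def simultaneousDecoder (T : Matrix ((∀ k, Q k) × D) ((∀ k, Q k) × D) ℂ)
    (m : ∀ k, Fin (M k)) :
    Matrix ((∀ k, Fin (M k) → Q k) × D) ((∀ k, Fin (M k) → Q k) × D) ℂ :=
  cfc (fun x : ℝ => x ^ (-(1 / 2) : ℝ)) (∑ m' : ∀ k, Fin (M k), checkOp T m') *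
    checkOp T m *
    cfc (fun x : ℝ => x ^ (-(1 / 2) : ℝ)) (∑ m' : ∀ k, Fin (M k), checkOp T m')

/-- The code employs a (position-based) quantum simultaneous decoder: its POVM is the square-root
measurement built from a test operator `0 ≤ T ≤ I`. -/
def EACode.UsesSimultaneousDecoder {A' B : Fin K → Type} [∀ k, Fintype (A' k)]
    [∀ k, Fintype (B k)] (c : EACode M (fun k => Fin (M k) → Q k) A' B D) : Prop :=
  ∃ T : Matrix ((∀ k, Q k) × D) ((∀ k, Q k) × D) ℂ,
    T.PosSemidef ∧ (1 - T).PosSemidef ∧ ∀ m, c.dec m = simultaneousDecoder T m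

end Decoder

/-- The rates `rate k` (in bits per channel use) are achievable for entanglement-assisted classical
communication over `N`, employing a quantum simultaneous decoder: for all `ε ∈ (0,1)`, `δ > 0` and
all sufficiently large `n` there is such a code for `N^{⊗n}` with `⌈2^{n (rate k - δ)}⌉` messages
for sender `k` and average error probability at most `ε`. -/
def AchievableSimultaneously {K : ℕ} {A : Fin K → Type} {C : Type}
    [∀ k, Fintype (A k)] [∀ k, DecidableEq (A k)] [Fintype C] [DecidableEq C]
    (N : Matrix (∀ k, A k) (∀ k, A k) ℂ →ₗ[ℂ] Matrix C C ℂ) (rate : Fin K → ℝ) : Prop :=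
  ∀ ε : ℝ, 0 < ε → ε < 1 → ∀ δ : ℝ, 0 < δ → ∃ n₀ : ℕ, ∀ n : ℕ, n₀ ≤ n →
    ∃ (M : Fin K → ℕ) (_ : ∀ k, M k = ⌈(2 : ℝ) ^ ((n : ℝ) * (rate k - δ))⌉₊)
      (Q A' : Fin K → Type) (_ : ∀ k, Fintype (Q k)) (_ : ∀ k, DecidableEq (Q k))
      (_ : ∀ k, Fintype (A' k))
      (c : EACode M (fun k => Fin (M k) → Q k) A' (fun k => Fin n → A k) (Fin n → C)),
      c.UsesSimultaneousDecoder ∧ c.avgError (tensorPower N n) ≤ ε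

end

end QMAC

namespace QMAC

open scoped ComplexOrder Kronecker
open Matrix Filter Topology

noncomputable section

/-! ### Operator inequalities for finite positive matrices. -/

section Positivity

variable {ι κ : Type} [Fintype ι] [Fintype κ]

/-! The proof is position-based coding with a single test. Sender `k` shares `M k` copies of `θ k ^
⊗n` with the receiver and encodes by discarding all of its registers except the one numbered by the
message (`keepRegister`). For a test on the registers of a wrong tuple, the senders in the set `J`
of wrong guesses look independent: the state seen is `⨂_{k ∈ J} τ k ^ ⊗n` tensored with the marginal
of `ω^{⊗n}` on `S(Jᶜ)C`, where `τ k` is the reference marginal of `θ k`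
(`trace_checkOp_mul_atPositions`). The Hayashi–Nagaoka inequality then bounds the error by twice the
miss probability plus four times the sum of all false-alarm probabilities (`exists_positionCode`).

The test is `T = Q P Q`. Here `P` is a spectral projection of `ω^{⊗n}` with `P ≤ 2^{n(H(ω)+δ)}
ω^{⊗n}`, and `Q` is the product over the senders of projections that cut `τ k ^ ⊗n` down below
`2^{-n(H(τ k)-δ)}`. Both nearly preserve `ω^{⊗n}`, so `posSemidef_sandwich` makes misses rare. For a
false alarm on `J`, replace `P` by `ω^{⊗n}`, then the cut-down `τ k ^ ⊗n` by multiples of the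
identity. What remains is `Tr(m Q' m Q')`, with `m` the marginal on `S(Jᶜ)C` and `Q'` the part of
`Q` acting there, and this is at most `Tr m²` (`test_bound`). The three steps contribute `H(ω)`,
`∑_{k ∈ J} H(τ k)` and `H₂(S(Jᶜ)C)`, which combine to the rate bound because trace preservation
makes the reference systems independent. No commutation between `Q` and `ω` is needed, and one test
serves every `J`: this is what makes the decoder simultaneous, and why a Rényi entropy of order two
appears. -/

theorem exists_eq_conjTranspose_mul_self {A : Matrix ι ι ℂ} (hA : A.PosSemidef) :
    ∃ C : Matrix ι ι ℂ, A = Cᴴ * C := by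
  classical
  open scoped MatrixOrder in
  exact CStarAlgebra.nonneg_iff_eq_star_mul_self.mp hA.nonneg

/-- A pairing of positive operators is nonnegative. -/
theorem trace_mul_re_nonneg {A B : Matrix ι ι ℂ} (hA : A.PosSemidef) (hB : B.PosSemidef) :
    0 ≤ (A * B).trace.re := by
  classical
  obtain ⟨C, rfl⟩ := exists_eq_conjTranspose_mul_self hA
  rw [Matrix.mul_assoc, Matrix.trace_mul_comm]
  exact (Complex.le_def.mp (hB.mul_mul_conjTranspose_same C).trace_nonneg).1

theorem trace_mul_re_mono {A A' B : Matrix ι ι ℂ} (hA : (A' - A).PosSemidef)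
    (hB : B.PosSemidef) : (A * B).trace.re ≤ (A' * B).trace.re := by
  have := trace_mul_re_nonneg hA hB
  rw [Matrix.sub_mul, Matrix.trace_sub, Complex.sub_re] at this
  linarith

/-- The square root is operator monotone. -/
theorem posSemidef_sub_of_sq {A R : Matrix ι ι ℂ} (hA : A.PosSemidef) (hR : R.PosSemidef)
    (h : (R * R - A * A).PosSemidef) : (R - A).PosSemidef := by
  classical
  have hH : (R - A).IsHermitian := hR.isHermitian.sub hA.isHermitian
  rw [hH.posSemidef_iff_eigenvalues_nonneg]
  intro i
  by_contra hneg
  simp only [Pi.zero_apply, not_le] at hneg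
  set l := hH.eigenvalues i
  set v : ι → ℂ := ⇑(hH.eigenvectorBasis i) with hv
  have hev : (R - A) *ᵥ v = l • v := hH.mulVec_eigenvectorBasis i
  have hev' : star v ᵥ* (R - A) = l • star v := by
    have := congrArg star hev
    rw [Matrix.star_mulVec, hH.eq] at this
    rw [this]
    ext j
    simp
  -- For an eigenvector of `R - A` with eigenvalue `l < 0`, positivity of `R² - A²` forces the sum
  -- of the two expectations to be nonpositive, hence both vanish; but their difference is `l ‖v‖² <
  -- 0`.
  have key : star v ⬝ᵥ ((R * R - A * A) *ᵥ v)
      = (l : ℂ) * (star v ⬝ᵥ (R *ᵥ v) + star v ⬝ᵥ (A *ᵥ v)) := by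
    have e : R * R - A * A = (R - A) * R + A * (R - A) := by noncomm_ring
    rw [e, Matrix.add_mulVec, dotProduct_add, ← Matrix.mulVec_mulVec, ← Matrix.mulVec_mulVec, hev,
      Matrix.dotProduct_mulVec, hev', Matrix.mulVec_smul, mul_add]
    simp [smul_dotProduct, dotProduct_smul]
  have hv0 : v ≠ 0 := by
    intro h0
    have : hH.eigenvectorBasis i = 0 := by
      ext j
      exact congrFun h0 j
    exact (hH.eigenvectorBasis.orthonormal.ne_zero i) this
  have e1 : star v ⬝ᵥ (R *ᵥ v) - star v ⬝ᵥ (A *ᵥ v) = (l : ℂ) * (star v ⬝ᵥ v) := by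
    rw [← dotProduct_sub, ← Matrix.sub_mulVec, hev]
    simp [dotProduct_smul]
  have h1 := (Complex.le_def.mp (h.dotProduct_mulVec_nonneg v)).1
  have h2 := (Complex.le_def.mp (hR.dotProduct_mulVec_nonneg v)).1
  have h3 := (Complex.le_def.mp (hA.dotProduct_mulVec_nonneg v)).1
  have h4 := (Complex.lt_def.mp (dotProduct_star_self_pos_iff.mpr hv0)).1
  rw [key, Complex.re_ofReal_mul, Complex.add_re] at h1
  have e2 := congrArg Complex.re e1
  rw [Complex.sub_re, Complex.re_ofReal_mul] at e2
  simp only [Complex.zero_re] at *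
  have h5 : (star v ⬝ᵥ (R *ᵥ v)).re + (star v ⬝ᵥ (A *ᵥ v)).re ≤ 0 := by
    by_contra hc
    push Not at hc
    nlinarith
  nlinarith

theorem posSemidef_sub_sq [DecidableEq ι] {A : Matrix ι ι ℂ} (hA : A.PosSemidef)
    (hA1 : (1 - A).PosSemidef) : (A - A * A).PosSemidef := by
  have h1 := hA1.mul_mul_conjTranspose_same A
  have h2 := hA.mul_mul_conjTranspose_same (1 - A)
  rw [hA.isHermitian.eq] at h1
  rw [hA1.isHermitian.eq] at h2
  convert h1.add h2 using 1
  noncomm_ring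

/-- The Hayashi–Nagaoka operator inequality, with `X = R⁻¹` and `R² = A + B`. -/
theorem hayashi_nagaoka [DecidableEq ι] {A B X R : Matrix ι ι ℂ} (hA : A.PosSemidef)
    (hA1 : (1 - A).PosSemidef) (hB : B.PosSemidef) (hR : R.PosSemidef) (hX : X.IsHermitian)
    (hRR : R * R = A + B) (hXR : X * R = 1) (hRX : R * X = 1) :
    ((2 : ℂ) • (1 - A) + (4 : ℂ) • B - (1 - X * A * X)).PosSemidef := by
  -- `A² ≤ A ≤ A + B = R²`, so monotonicity of the square root applies.
  have h0 : (R - A).PosSemidef := by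
    refine posSemidef_sub_of_sq hA hR ?_
    rw [hRR]
    convert (posSemidef_sub_sq hA hA1).add hB using 1
    abel
  have h1 := hB.mul_mul_conjTranspose_same (X - 2)
  have h2 := hA.mul_mul_conjTranspose_same (X - 1)
  have e1 : (X - 2)ᴴ = X - 2 := by
    rw [Matrix.conjTranspose_sub, hX.eq, Matrix.conjTranspose_ofNat]
  have e2 : (X - 1)ᴴ = X - 1 := by
    rw [Matrix.conjTranspose_sub, hX.eq, Matrix.conjTranspose_one]
  rw [e1] at h1
  rw [e2] at h2
  have hS : X * (A + B) * X = 1 := by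
    rw [← hRR, ← Matrix.mul_assoc, hXR, Matrix.one_mul, hRX]
  have hS1 : X * (A + B) = R := by rw [← hRR, ← Matrix.mul_assoc, hXR, Matrix.one_mul]
  have hS2 : (A + B) * X = R := by rw [← hRR, Matrix.mul_assoc, hRX, Matrix.mul_one]
  -- The difference equals `(X - 2) B (X - 2) + 2 (X - 1) A (X - 1) + 4 (R - A)`.
  convert (h1.add (h2.add h2)).add ((h0.add h0).add (h0.add h0)) using 1
  have e3 : X * A * X = 1 - X * B * X := by rw [← hS]; noncomm_ring
  have e4 : X * A = R - X * B := by rw [← hS1]; noncomm_ring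
  have e5 : A * X = R - B * X := by rw [← hS2]; noncomm_ring
  have e6 : (X - 1) * A * (X - 1) = X * A * X - X * A - A * X + A := by noncomm_ring
  have e7 : (X - 2) * B * (X - 2) = X * B * X - 2 * (X * B) - 2 * (B * X) + 4 * B := by
    noncomm_ring
  rw [e6, e7, e3, e4, e5, two_smul, show (4 : ℂ) • B = B + B + B + B by module]
  noncomm_ring

/-- `1 - QPQ ≤ 2 (1 - P) + 4 (1 - Q)`. -/
theorem posSemidef_sandwich [DecidableEq ι] {P Q : Matrix ι ι ℂ} (hP : P.PosSemidef)
    (hP1 : (1 - P).PosSemidef) (hQ : Q.PosSemidef) (hQ1 : (1 - Q).PosSemidef) :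
    ((2 : ℂ) • (1 - P) + (4 : ℂ) • (1 - Q) - (1 - Q * P * Q)).PosSemidef := by
  have h1 := hP1.mul_mul_conjTranspose_same (1 + 1 - Q)
  have h2 := hP.mul_mul_conjTranspose_same (1 - Q)
  have h3 := posSemidef_sub_sq hQ hQ1
  have e1 : (1 + 1 - Q)ᴴ = 1 + 1 - Q := by
    rw [Matrix.conjTranspose_sub, hQ.isHermitian.eq, Matrix.conjTranspose_add,
      Matrix.conjTranspose_one]
  rw [hQ1.isHermitian.eq] at h2
  rw [e1] at h1
  -- The difference equals `(2 - Q)(1 - P)(2 - Q) + 2 (1 - Q) P (1 - Q) + (1 - Q) + (Q - Q²)`; `Q`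
  -- need not be a projection.
  convert ((h1.add h2).add h2).add (hQ1.add h3) using 1
  rw [two_smul, show (4 : ℂ) • (1 - Q) = (1 - Q) + (1 - Q) + (1 - Q) + (1 - Q) by module]
  noncomm_ring

theorem posSemidef_sandwich_one [DecidableEq ι] {P Q : Matrix ι ι ℂ}
    (hP1 : (1 - P).PosSemidef) (hQ : Q.PosSemidef) (hQ1 : (1 - Q).PosSemidef) :
    (1 - Q * P * Q).PosSemidef := by
  have h1 := hP1.mul_mul_conjTranspose_same Q
  rw [hQ.isHermitian.eq] at h1
  have h3 := posSemidef_sub_sq hQ hQ1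
  convert (h1.add h3).add hQ1 using 1
  noncomm_ring

end Positivity

/-! ### The square-root measurement. -/

section SquareRootMeasurement

variable {ι : Type} [Fintype ι] [DecidableEq ι]

/-- On a strictly positive spectrum `x^{-1/2} √x = 1`, so the inverse square root of the decoder is
a genuine inverse and not merely one on the support. -/
theorem exists_sqrt_of_posDef {S : Matrix ι ι ℂ} (hS : S.PosDef) :
    (cfc (fun x : ℝ => x ^ (-(1 / 2) : ℝ)) S).IsHermitian ∧ ∃ R : Matrix ι ι ℂ, R.PosSemidef ∧
      R * R = S ∧ cfc (fun x : ℝ => x ^ (-(1 / 2) : ℝ)) S * R = 1 ∧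
      R * cfc (fun x : ℝ => x ^ (-(1 / 2) : ℝ)) S = 1 := by
  have hc : ∀ f : ℝ → ℝ, ContinuousOn f (spectrum ℝ S) := fun f =>
    S.finite_real_spectrum.continuousOn f
  have hsa : IsSelfAdjoint S := hS.isHermitian
  have hpos : ∀ x ∈ spectrum ℝ S, 0 < x := by
    intro x hx
    rw [hS.isHermitian.spectrum_real_eq_range_eigenvalues] at hx
    obtain ⟨i, rfl⟩ := hx
    exact hS.eigenvalues_pos i
  have hX : IsSelfAdjoint (cfc (fun x : ℝ => x ^ (-(1 / 2) : ℝ)) S) := cfc_predicate _ _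
  refine ⟨hX, cfc Real.sqrt S, ?_, ?_, ?_, ?_⟩
  · open scoped MatrixOrder in
    exact Matrix.nonneg_iff_posSemidef.mp (cfc_nonneg fun x _ => Real.sqrt_nonneg x)
  · rw [← cfc_mul _ _ S (hc _) (hc _)]
    conv_rhs => rw [← cfc_id ℝ S]
    exact cfc_congr fun x hx => Real.mul_self_sqrt (hpos x hx).le
  · rw [← cfc_mul _ _ S (hc _) (hc _), ← cfc_one ℝ S]
    refine cfc_congr fun x hx => ?_
    simp only [Pi.one_apply]
    rw [Real.sqrt_eq_rpow, ← Real.rpow_add (hpos x hx)]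
    norm_num
  · rw [← cfc_mul _ _ S (hc _) (hc _), ← cfc_one ℝ S]
    refine cfc_congr fun x hx => ?_
    simp only [Pi.one_apply]
    rw [Real.sqrt_eq_rpow, ← Real.rpow_add (hpos x hx)]
    norm_num

variable {μ : Type} [Fintype μ] {Γ : μ → Matrix ι ι ℂ}

theorem squareRootMeasurement_posSemidef (hΓ : ∀ m, (Γ m).PosSemidef)
    (hS : (∑ m, Γ m).PosDef) (m : μ) :
    (cfc (fun x : ℝ => x ^ (-(1 / 2) : ℝ)) (∑ m, Γ m) * Γ m *
      cfc (fun x : ℝ => x ^ (-(1 / 2) : ℝ)) (∑ m, Γ m)).PosSemidef := by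
  obtain ⟨hX, -⟩ := exists_sqrt_of_posDef hS
  have := (hΓ m).mul_mul_conjTranspose_same (cfc (fun x : ℝ => x ^ (-(1 / 2) : ℝ)) (∑ m, Γ m))
  rwa [hX.eq] at this

theorem squareRootMeasurement_sum (hS : (∑ m, Γ m).PosDef) :
    ∑ m, cfc (fun x : ℝ => x ^ (-(1 / 2) : ℝ)) (∑ m, Γ m) * Γ m *
      cfc (fun x : ℝ => x ^ (-(1 / 2) : ℝ)) (∑ m, Γ m) = 1 := by
  obtain ⟨-, R, -, hRR, hXR, hRX⟩ := exists_sqrt_of_posDef hS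
  rw [← Finset.sum_mul, ← Finset.mul_sum]
  generalize cfc (fun x : ℝ => x ^ (-(1 / 2) : ℝ)) (∑ m, Γ m) = X at *
  rw [← hRR, ← Matrix.mul_assoc, hXR, Matrix.one_mul, hRX]

/-- Hayashi–Nagaoka with `A = Γ m` and `B` the sum of the other operators: a quantum union bound. -/
theorem squareRootMeasurement_error_le [DecidableEq μ] (hΓ : ∀ m, (Γ m).PosSemidef)
    (hΓ1 : ∀ m, (1 - Γ m).PosSemidef) (hS : (∑ m, Γ m).PosDef) {ρ : Matrix ι ι ℂ}
    (hρ : ρ.PosSemidef) (m : μ) :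
    ((1 - cfc (fun x : ℝ => x ^ (-(1 / 2) : ℝ)) (∑ m, Γ m) * Γ m *
      cfc (fun x : ℝ => x ^ (-(1 / 2) : ℝ)) (∑ m, Γ m)) * ρ).trace.re ≤
      2 * ((1 - Γ m) * ρ).trace.re + 4 * ∑ m' ∈ Finset.univ.erase m, (Γ m' * ρ).trace.re := by
  obtain ⟨hX, R, hR, hRR, hXR, hRX⟩ := exists_sqrt_of_posDef hS
  have hsum : Γ m + ∑ m' ∈ Finset.univ.erase m, Γ m' = ∑ m, Γ m :=
    Finset.add_sum_erase _ _ (Finset.mem_univ m)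
  have h := hayashi_nagaoka (hΓ m) (hΓ1 m)
    (Matrix.posSemidef_sum (Finset.univ.erase m) fun m' _ => hΓ m') hR hX (hRR.trans hsum.symm)
    hXR hRX
  refine (trace_mul_re_mono h hρ).trans_eq ?_
  rw [Matrix.add_mul, Matrix.smul_mul, Matrix.smul_mul, Matrix.trace_add, Matrix.trace_smul,
    Matrix.trace_smul, Finset.sum_mul, Matrix.trace_sum]
  simp [Complex.re_sum]

end SquareRootMeasurement

/-! ### Tensor products of families of operators. -/

section TensorProduct

variable {ι : Type} [Fintype ι] {κ : ι → Type}

/-- The tensor product of a family of operators. -/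
def piTensor (X : ∀ i, Matrix (κ i) (κ i) ℂ) : Matrix (∀ i, κ i) (∀ i, κ i) ℂ :=
  fun p q => ∏ i, X i (p i) (q i)

theorem piTensor_conjTranspose (X : ∀ i, Matrix (κ i) (κ i) ℂ) :
    (piTensor X)ᴴ = piTensor fun i => (X i)ᴴ := by
  ext p q
  simp [piTensor, Matrix.conjTranspose_apply]

theorem piTensor_diagonal [∀ i, DecidableEq (κ i)] (d : ∀ i, κ i → ℂ) :
    piTensor (fun i => diagonal (d i)) = diagonal fun p => ∏ i, d i (p i) := by
  ext p q
  by_cases h : p = q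
  · subst h
    simp [piTensor]
  · rw [diagonal_apply_ne _ h]
    obtain ⟨i, hi⟩ := Function.ne_iff.mp h
    exact Finset.prod_eq_zero (Finset.mem_univ i) (diagonal_apply_ne _ hi)

variable [DecidableEq ι] [∀ i, Fintype (κ i)]

theorem piTensor_mul (X Y : ∀ i, Matrix (κ i) (κ i) ℂ) :
    piTensor X * piTensor Y = piTensor fun i => X i * Y i := by
  ext p q
  simp only [piTensor, Matrix.mul_apply]
  rw [Finset.prod_univ_sum, Fintype.piFinset_univ]
  simp [Finset.prod_mul_distrib]

theorem piTensor_trace (X : ∀ i, Matrix (κ i) (κ i) ℂ) :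
    (piTensor X).trace = ∏ i, (X i).trace := by
  simp only [piTensor, Matrix.trace, Matrix.diag]
  rw [Finset.prod_univ_sum, Fintype.piFinset_univ]

theorem piTensor_posSemidef {X : ∀ i, Matrix (κ i) (κ i) ℂ} (hX : ∀ i, (X i).PosSemidef) :
    (piTensor X).PosSemidef := by
  choose C hC using fun i => exists_eq_conjTranspose_mul_self (hX i)
  rw [show X = fun i => (C i)ᴴ * C i from funext hC, ← piTensor_mul, ← piTensor_conjTranspose]
  exact Matrix.posSemidef_conjTranspose_mul_self _

theorem piTensor_isState {X : ∀ i, Matrix (κ i) (κ i) ℂ} (hX : ∀ i, IsState (X i)) :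
    IsState (piTensor X) :=
  ⟨piTensor_posSemidef fun i => (hX i).1, by simp [piTensor_trace, (hX _).2]⟩

end TensorProduct

/-! ### Operators diagonal in a fixed orthonormal basis. -/

section ConjDiag

variable {ι : Type} [Fintype ι] [DecidableEq ι]

/-- The operator with eigenvalues `d` in the basis given by the columns of `U`. -/
def conjDiag (U : Matrix ι ι ℂ) (d : ι → ℝ) : Matrix ι ι ℂ :=
  U * diagonal (fun i => (d i : ℂ)) * Uᴴ

variable {U : Matrix ι ι ℂ}

theorem conjDiag_mul (hU : Uᴴ * U = 1) (d e : ι → ℝ) :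
    conjDiag U d * conjDiag U e = conjDiag U (fun i => d i * e i) := by
  have : conjDiag U d * conjDiag U e
      = U * diagonal (fun i => (d i : ℂ)) * (Uᴴ * U) * diagonal (fun i => (e i : ℂ)) * Uᴴ := by
    simp only [conjDiag, Matrix.mul_assoc]
  rw [this, hU, Matrix.mul_one, Matrix.mul_assoc U, diagonal_mul_diagonal]
  simp [conjDiag]

theorem conjDiag_sub (d e : ι → ℝ) :
    conjDiag U d - conjDiag U e = conjDiag U (fun i => d i - e i) := by
  simp only [conjDiag, ← Matrix.sub_mul, ← Matrix.mul_sub, diagonal_sub, Complex.ofReal_sub]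

theorem smul_conjDiag (c : ℝ) (d : ι → ℝ) :
    (c : ℂ) • conjDiag U d = conjDiag U (fun i => c * d i) := by
  rw [conjDiag, conjDiag, ← Matrix.smul_mul, ← Matrix.mul_smul]
  congr 2
  ext i j
  by_cases h : i = j <;> simp [h]

theorem conjDiag_one (hU : U * Uᴴ = 1) : conjDiag U (fun _ => 1) = 1 := by
  simp [conjDiag, hU]

theorem conjDiag_posSemidef {d : ι → ℝ} (hd : ∀ i, 0 ≤ d i) : (conjDiag U d).PosSemidef :=
  (PosSemidef.diagonal (d := fun i => (d i : ℂ)) fun i =>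
    Complex.zero_le_real.mpr (hd i)).mul_mul_conjTranspose_same U

theorem conjDiag_trace (hU : Uᴴ * U = 1) (d : ι → ℝ) :
    (conjDiag U d).trace = ((∑ i, d i : ℝ) : ℂ) := by
  rw [conjDiag, Matrix.mul_assoc, Matrix.trace_mul_comm, Matrix.mul_assoc, hU, Matrix.mul_one,
    trace_diagonal, Complex.ofReal_sum]

theorem exists_eq_conjDiag {ρ : Matrix ι ι ℂ} (hρ : ρ.IsHermitian) :
    ∃ U : Matrix ι ι ℂ, Uᴴ * U = 1 ∧ U * Uᴴ = 1 ∧ ρ = conjDiag U hρ.eigenvalues := by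
  refine ⟨hρ.eigenvectorUnitary, ?_, ?_, ?_⟩
  · exact Unitary.coe_star_mul_self hρ.eigenvectorUnitary
  · exact Unitary.coe_mul_star_self hρ.eigenvectorUnitary
  · conv_lhs => rw [hρ.spectral_theorem]
    rfl

/-- `entropy` is computed from one particular enumeration of the eigenvalues. The characteristic
polynomial fixes their multiset, so any diagonalization gives the same sum. -/
theorem entropy_conjDiag (hU : Uᴴ * U = 1) (d : ι → ℝ) :
    entropy (conjDiag U d) = ∑ i, Real.negMulLog (d i) / Real.log 2 := by
  have hH : (conjDiag U d).IsHermitian := by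
    rw [conjDiag, Matrix.IsHermitian, Matrix.conjTranspose_mul, Matrix.conjTranspose_mul,
      Matrix.conjTranspose_conjTranspose, Matrix.mul_assoc, diagonal_conjTranspose]
    congr 3
    ext i
    simp
  have h1 := hH.roots_charpoly_eq_eigenvalues
  have h2 : (conjDiag U d).charpoly = (diagonal fun i => (d i : ℂ)).charpoly := by
    rw [conjDiag, Matrix.charpoly_mul_comm, ← Matrix.mul_assoc, hU, Matrix.one_mul]
  rw [h2, Matrix.charpoly_diagonal, Polynomial.roots_prod _ _
    (Finset.prod_ne_zero_iff.mpr fun i _ => Polynomial.X_sub_C_ne_zero _)] at h1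
  simp only [Polynomial.roots_X_sub_C, Multiset.bind_singleton] at h1
  have h3 := congrArg (fun s : Multiset ℂ =>
    (s.map fun z => Real.negMulLog z.re / Real.log 2).sum) h1
  simp only [Multiset.map_map, Function.comp_def, Complex.ofReal_re, Complex.coe_algebraMap] at h3
  rw [entropy, dif_pos hH]
  exact h3.symm

end ConjDiag

theorem piTensor_conjDiag {ι : Type} [Fintype ι] [DecidableEq ι] {κ : ι → Type}
    [∀ i, Fintype (κ i)] [∀ i, DecidableEq (κ i)] (U : ∀ i, Matrix (κ i) (κ i) ℂ)
    (d : ∀ i, κ i → ℝ) :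
    piTensor (fun i => conjDiag (U i) (d i)) =
      conjDiag (piTensor U) (fun p => ∏ i, d i (p i)) := by
  simp only [conjDiag]
  rw [← piTensor_mul, ← piTensor_mul, piTensor_diagonal, piTensor_conjTranspose]
  simp

theorem piTensor_one {ι : Type} [Fintype ι] {κ : ι → Type} [∀ i, DecidableEq (κ i)] :
    piTensor (fun i => (1 : Matrix (κ i) (κ i) ℂ)) = 1 := by
  have := piTensor_diagonal (fun (i : ι) (_ : κ i) => (1 : ℂ))
  simpa only [diagonal_one, Finset.prod_const_one] using this

/-! ### One-sided typicality for i.i.d. strings. -/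

section Typicality

variable {ι : Type} [Fintype ι]

theorem sum_pi_prod_eq_pow (n : ℕ) (f : ι → ℝ) :
    ∑ x : Fin n → ι, ∏ i, f (x i) = (∑ a, f a) ^ n := by
  classical
  rw [← Fin.prod_const, Finset.prod_univ_sum, Fintype.piFinset_univ]

/-- A one-sided weak law of large numbers for finite alphabets: the empirical sum of a function
with negative mean is positive with vanishing probability. -/
theorem tendsto_sum_positive_zero {p L : ι → ℝ} (hp : ∀ i, 0 ≤ p i) (hp1 : ∑ i, p i = 1)
    (hL : ∑ i, p i * L i < 0) :
    Tendsto (fun n : ℕ => ∑ x : Fin n → ι, if 0 < ∑ i, L (x i) then ∏ i, p (x i) else 0)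
      atTop (𝓝 0) := by
  have hg : HasDerivAt (fun s : ℝ => ∑ i, p i * Real.exp (s * L i)) (∑ i, p i * L i) 0 := by
    have : ∀ i ∈ Finset.univ, HasDerivAt (fun s : ℝ => p i * Real.exp (s * L i)) (p i * L i) 0 := by
      intro i _
      have := (((hasDerivAt_id (0 : ℝ)).mul_const (L i)).exp).const_mul (p i)
      simpa using this
    simpa using HasDerivAt.fun_sum this
  -- The moment generating function is `1` at `0` with negative derivative there, so it drops below
  -- `1` at some `s > 0`. The Chernoff bound with this `s` decays exponentially.
  obtain ⟨s, hs0, hs1⟩ : ∃ s : ℝ, 0 < s ∧ ∑ i, p i * Real.exp (s * L i) < 1 := by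
    have h := hg.hasDerivWithinAt (s := Set.Ioi 0)
    rw [hasDerivWithinAt_iff_tendsto_slope' (by simp)] at h
    have h2 := (h.eventually (gt_mem_nhds hL)).and self_mem_nhdsWithin
    obtain ⟨s, hs, hs0⟩ := h2.exists
    refine ⟨s, hs0, ?_⟩
    rw [slope_def_field, div_neg_iff] at hs
    simp only [zero_mul, Real.exp_zero, mul_one, hp1, sub_zero] at hs
    have : (0 : ℝ) < s := hs0
    rcases hs with hs | hs
    · linarith [hs.2]
    · linarith [hs.1]
  have hpow := tendsto_pow_atTop_nhds_zero_of_lt_one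
    (Finset.sum_nonneg fun i _ => mul_nonneg (hp i) (Real.exp_pos (s * L i)).le) hs1
  refine squeeze_zero (fun n => ?_) (fun n => ?_) hpow
  · exact Finset.sum_nonneg fun x _ => by
      split_ifs
      · exact Finset.prod_nonneg fun i _ => hp _
      · exact le_rfl
  · rw [← sum_pi_prod_eq_pow]
    refine Finset.sum_le_sum fun x _ => ?_
    rw [Finset.prod_mul_distrib, ← Real.exp_sum, ← Finset.mul_sum]
    have h0 : 0 ≤ ∏ i, p (x i) := Finset.prod_nonneg fun i _ => hp _
    split_ifs with h
    · exact le_mul_of_one_le_right h0 (Real.one_le_exp (mul_nonneg hs0.le h.le))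
    · positivity

theorem log_prod_of_ne_zero {α : Type} {n : ℕ} {p : α → ℝ} {x : Fin n → α} (h : ∏ i, p (x i) ≠ 0) :
    Real.log (∏ i, p (x i)) = ∑ i, Real.log (p (x i)) :=
  Real.log_prod fun i hi => Finset.prod_ne_zero_iff.mp h i hi

/-- The law of large numbers above, applied to `L = -(log p + h log 2)`, whose mean is `(H - h) log
2 < 0`, with `H` the entropy in bits. Strings of probability zero are set aside, since `log 0 = 0`
would spoil the comparison of logarithms. -/
theorem tendsto_prob_small {p : ι → ℝ} (hp : ∀ i, 0 ≤ p i) (hp1 : ∑ i, p i = 1) {h : ℝ}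
    (hh : ∑ i, Real.negMulLog (p i) / Real.log 2 < h) :
    Tendsto (fun n : ℕ => ∑ x : Fin n → ι,
      if ∏ i, p (x i) < (2 : ℝ) ^ (-(n * h)) then ∏ i, p (x i) else 0) atTop (𝓝 0) := by
  have h2 : 0 < Real.log 2 := Real.log_pos one_lt_two
  have hL : ∑ i, p i * -(Real.log (p i) + h * Real.log 2) < 0 := by
    rw [← Finset.sum_div, div_lt_iff₀ h2] at hh
    have : ∑ i, p i * -(Real.log (p i) + h * Real.log 2)
        = ∑ i, Real.negMulLog (p i) - h * Real.log 2 := by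
      conv_rhs => rw [← one_mul (h * Real.log 2), ← hp1, Finset.sum_mul, ← Finset.sum_sub_distrib]
      exact Finset.sum_congr rfl fun i _ => by rw [Real.negMulLog]; ring
    linarith
  refine squeeze_zero (fun n => ?_) (fun n => ?_) (tendsto_sum_positive_zero hp hp1 hL)
  · exact Finset.sum_nonneg fun x _ => by
      split_ifs
      · exact Finset.prod_nonneg fun i _ => hp _
      · exact le_rfl
  · refine Finset.sum_le_sum fun x _ => ?_
    have h0 : 0 ≤ ∏ i, p (x i) := Finset.prod_nonneg fun i _ => hp _
    rcases h0.eq_or_lt with h0 | h0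
    · simp [← h0]
    split_ifs with h3 h4
    · exact le_rfl
    · refine absurd ?_ h4
      have := Real.log_lt_log h0 h3
      rw [log_prod_of_ne_zero h0.ne', Real.log_rpow two_pos] at this
      rw [Finset.sum_neg_distrib, Finset.sum_add_distrib, Finset.sum_const, Finset.card_univ,
        Fintype.card_fin, nsmul_eq_mul]
      linarith
    · exact h0.le
    · exact le_rfl

theorem tendsto_prob_large {p : ι → ℝ} (hp : ∀ i, 0 ≤ p i) (hp1 : ∑ i, p i = 1) {h : ℝ}
    (hh : h < ∑ i, Real.negMulLog (p i) / Real.log 2) :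
    Tendsto (fun n : ℕ => ∑ x : Fin n → ι,
      if (2 : ℝ) ^ (-(n * h)) < ∏ i, p (x i) then ∏ i, p (x i) else 0) atTop (𝓝 0) := by
  have h2 : 0 < Real.log 2 := Real.log_pos one_lt_two
  have hL : ∑ i, p i * (Real.log (p i) + h * Real.log 2) < 0 := by
    rw [← Finset.sum_div, lt_div_iff₀ h2] at hh
    have : ∑ i, p i * (Real.log (p i) + h * Real.log 2)
        = h * Real.log 2 - ∑ i, Real.negMulLog (p i) := by
      conv_rhs => rw [← one_mul (h * Real.log 2), ← hp1, Finset.sum_mul, ← Finset.sum_sub_distrib]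
      exact Finset.sum_congr rfl fun i _ => by rw [Real.negMulLog]; ring
    linarith
  refine squeeze_zero (fun n => ?_) (fun n => ?_) (tendsto_sum_positive_zero hp hp1 hL)
  · exact Finset.sum_nonneg fun x _ => by
      split_ifs
      · exact Finset.prod_nonneg fun i _ => hp _
      · exact le_rfl
  · refine Finset.sum_le_sum fun x _ => ?_
    have h0 : 0 ≤ ∏ i, p (x i) := Finset.prod_nonneg fun i _ => hp _
    rcases h0.eq_or_lt with h0 | h0
    · simp [← h0]
    split_ifs with h3 h4
    · exact le_rfl
    · refine absurd ?_ h4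
      have := Real.log_lt_log (Real.rpow_pos_of_pos two_pos _) h3
      rw [log_prod_of_ne_zero h0.ne', Real.log_rpow two_pos] at this
      rw [Finset.sum_add_distrib, Finset.sum_const, Finset.card_univ,
        Fintype.card_fin, nsmul_eq_mul]
      linarith
    · exact h0.le
    · exact le_rfl

end Typicality

/-! ### Spectral projections of i.i.d. states, and additivity of entropy. -/

section TypicalProjector

variable {ι : Type} [Fintype ι] [DecidableEq ι]

theorem IsState.exists_spectral {ρ : Matrix ι ι ℂ} (hρ : IsState ρ) :
    ∃ (U : Matrix ι ι ℂ) (p : ι → ℝ), Uᴴ * U = 1 ∧ U * Uᴴ = 1 ∧ (∀ i, 0 ≤ p i) ∧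
      ∑ i, p i = 1 ∧ ρ = conjDiag U p ∧ entropy ρ = ∑ i, Real.negMulLog (p i) / Real.log 2 := by
  obtain ⟨U, hU, hU', h⟩ := exists_eq_conjDiag hρ.1.isHermitian
  refine ⟨U, _, hU, hU', hρ.1.eigenvalues_nonneg, ?_, h, ?_⟩
  · have h1 := hρ.2
    rw [h, conjDiag_trace hU] at h1
    exact_mod_cast h1
  · conv_lhs => rw [h]
    exact entropy_conjDiag hU _

theorem piTensor_unitary {n : ℕ} {U : Matrix ι ι ℂ} (hU : Uᴴ * U = 1) :
    (piTensor fun _ : Fin n => U)ᴴ * (piTensor fun _ : Fin n => U) = 1 := by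
  rw [piTensor_conjTranspose, piTensor_mul, hU, piTensor_one]

/-- For large `n` there is an effect that nearly preserves `ρ^{⊗n}` and is dominated by
`2^{nh} ρ^{⊗n}`, for `h` above the entropy. -/
theorem eventually_exists_effect_le {ρ : Matrix ι ι ℂ} (hρ : IsState ρ) {h ε : ℝ}
    (hh : entropy ρ < h) (hε : 0 < ε) :
    ∀ᶠ n : ℕ in atTop, ∃ P : Matrix (Fin n → ι) (Fin n → ι) ℂ, P.PosSemidef ∧
      (1 - P).PosSemidef ∧
      ((((2 : ℝ) ^ ((n : ℝ) * h) : ℝ) : ℂ) • piTensor (fun _ : Fin n => ρ) - P).PosSemidef ∧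
      1 - ε ≤ (P * piTensor fun _ : Fin n => ρ).trace.re := by
  obtain ⟨U, p, hU, hU', hp, hp1, rfl, he⟩ := hρ.exists_spectral
  rw [he] at hh
  filter_upwards [(tendsto_prob_small hp hp1 hh).eventually (ge_mem_nhds hε)] with n hn
  have hV := piTensor_unitary (n := n) hU
  have hV' := mul_eq_one_comm.mp hV
  set V := piTensor fun _ : Fin n => U
  have hprod : ∀ x : Fin n → ι, 0 ≤ ∏ i, p (x i) := fun x => Finset.prod_nonneg fun i _ => hp _
  -- The spectral projection onto eigenvalues at least `2^{-nh}`: on its range `1 ≤ 2^{nh} λ`,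
  -- elsewhere it vanishes.
  refine ⟨conjDiag V fun x => if ∏ i, p (x i) < (2 : ℝ) ^ (-(n * h)) then 0 else 1,
    ?_, ?_, ?_, ?_⟩
  · exact conjDiag_posSemidef fun x => by split_ifs <;> norm_num
  · rw [← conjDiag_one hV', conjDiag_sub]
    exact conjDiag_posSemidef fun x => by split_ifs <;> norm_num
  · rw [piTensor_conjDiag, smul_conjDiag, conjDiag_sub]
    refine conjDiag_posSemidef fun x => ?_
    split_ifs with hx
    · have := hprod x
      simp only [sub_zero]
      positivity
    · rw [sub_nonneg]
      rw [not_lt, Real.rpow_neg two_pos.le] at hx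
      rwa [← inv_le_iff_one_le_mul₀' (by positivity)]
  · rw [piTensor_conjDiag, conjDiag_mul hV, conjDiag_trace hV, Complex.ofReal_re]
    have h1 : ∑ x : Fin n → ι, ∏ i, p (x i) = 1 := by rw [sum_pi_prod_eq_pow, hp1, one_pow]
    have h2 : ∑ x : Fin n → ι, (if ∏ i, p (x i) < (2 : ℝ) ^ (-(n * h)) then (0 : ℝ) else 1)
          * ∏ i, p (x i)
        = 1 - ∑ x : Fin n → ι, (if ∏ i, p (x i) < (2 : ℝ) ^ (-(n * h)) then ∏ i, p (x i) else 0) := by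
      rw [eq_sub_iff_add_eq, ← Finset.sum_add_distrib]
      refine Eq.trans ?_ h1
      exact Finset.sum_congr rfl fun x _ => by split_ifs <;> simp
    rw [h2]
    linarith

/-- For large `n` there is a projection that nearly preserves `ρ^{⊗n}` and cuts it down to an
operator below `2^{-nh}`, for `h` below the entropy. -/
theorem eventually_exists_projection_le {ρ : Matrix ι ι ℂ} (hρ : IsState ρ) {h ε : ℝ}
    (hh : h < entropy ρ) (hε : 0 < ε) :
    ∀ᶠ n : ℕ in atTop, ∃ (V : Matrix (Fin n → ι) (Fin n → ι) ℂ) (q r : (Fin n → ι) → ℝ),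
      Vᴴ * V = 1 ∧ piTensor (fun _ : Fin n => ρ) = conjDiag V r ∧ (∀ x, 0 ≤ r x) ∧
      (∀ x, q x = 0 ∨ q x = 1) ∧ (∀ x, q x * r x * q x ≤ (2 : ℝ) ^ (-((n : ℝ) * h))) ∧
      1 - ε ≤ (conjDiag V q * piTensor fun _ : Fin n => ρ).trace.re := by
  obtain ⟨U, p, hU, hU', hp, hp1, rfl, he⟩ := hρ.exists_spectral
  rw [he] at hh
  filter_upwards [(tendsto_prob_large hp hp1 hh).eventually (ge_mem_nhds hε)] with n hn
  have hV := piTensor_unitary (n := n) hU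
  set V := piTensor fun _ : Fin n => U
  -- Here the eigenvalues above `2^{-nh}` are removed. The common eigenbasis is returned with the
  -- projection, so that products of the projection and the state stay diagonal.
  refine ⟨V, fun x => if (2 : ℝ) ^ (-(n * h)) < ∏ i, p (x i) then 0 else 1,
    fun x => ∏ i, p (x i), hV, piTensor_conjDiag _ _,
    fun x => Finset.prod_nonneg fun i _ => hp _, ?_, ?_, ?_⟩
  · intro x
    dsimp only
    split_ifs <;> simp
  · intro x
    dsimp only
    split_ifs with hx
    · simp only [zero_mul]
      positivity
    · simpa using hx
  · rw [piTensor_conjDiag, conjDiag_mul hV, conjDiag_trace hV, Complex.ofReal_re]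
    have h1 : ∑ x : Fin n → ι, ∏ i, p (x i) = 1 := by rw [sum_pi_prod_eq_pow, hp1, one_pow]
    have h2 : ∑ x : Fin n → ι, (if (2 : ℝ) ^ (-(n * h)) < ∏ i, p (x i) then (0 : ℝ) else 1)
          * ∏ i, p (x i)
        = 1 - ∑ x : Fin n → ι, (if (2 : ℝ) ^ (-(n * h)) < ∏ i, p (x i) then ∏ i, p (x i) else 0) := by
      rw [eq_sub_iff_add_eq, ← Finset.sum_add_distrib]
      refine Eq.trans ?_ h1
      exact Finset.sum_congr rfl fun x _ => by split_ifs <;> simp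
    rw [h2]
    linarith

/-- The entropy of a product state is the sum of the entropies. -/
theorem entropy_piTensor {J : Type} [Fintype J] [DecidableEq J] {κ : J → Type}
    [∀ j, Fintype (κ j)] [∀ j, DecidableEq (κ j)] {ρ : ∀ j, Matrix (κ j) (κ j) ℂ}
    (hρ : ∀ j, IsState (ρ j)) : entropy (piTensor ρ) = ∑ j, entropy (ρ j) := by
  choose U p hU hU' hp hp1 h he using fun j => (hρ j).exists_spectral
  have hV : (piTensor U)ᴴ * piTensor U = 1 := by
    rw [piTensor_conjTranspose, piTensor_mul]
    simp only [hU, piTensor_one]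
  rw [Finset.sum_congr rfl fun j _ => he j]
  conv_lhs => rw [show ρ = fun j => conjDiag (U j) (p j) from funext h, piTensor_conjDiag,
    entropy_conjDiag hV]
  simp only [← Finset.sum_div]
  congr 1
  -- A Leibniz rule: each summand replaces one factor by its `negMulLog`. Summing over all strings,
  -- the other factors contribute total mass `1`.
  have key : ∀ x : ∀ j, κ j, Real.negMulLog (∏ j, p j (x j))
      = ∑ j, ∏ i, if i = j then Real.negMulLog (p i (x i)) else p i (x i) := by
    intro x
    have hterm : ∀ j, (∏ i, if i = j then Real.negMulLog (p i (x i)) else p i (x i))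
        = -((∏ i, p i (x i)) * Real.log (p j (x j))) := by
      intro j
      rw [← Finset.mul_prod_erase _ _ (Finset.mem_univ j), if_pos rfl,
        ← Finset.mul_prod_erase _ (fun i => p i (x i)) (Finset.mem_univ j),
        Finset.prod_congr rfl fun i hi => if_neg (Finset.ne_of_mem_erase hi), Real.negMulLog]
      ring
    rw [Finset.sum_congr rfl fun j _ => hterm j, Finset.sum_neg_distrib, ← Finset.mul_sum,
      Real.negMulLog]
    by_cases h0 : ∏ i, p i (x i) = 0
    · simp [h0]
    · rw [Real.log_prod fun i hi => Finset.prod_ne_zero_iff.mp h0 i hi]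
      ring
  simp only [key]
  rw [Finset.sum_comm]
  refine Finset.sum_congr rfl fun j _ => ?_
  have := Finset.prod_univ_sum (fun i => (Finset.univ : Finset (κ i)))
    (fun i a => if i = j then Real.negMulLog (p i a) else p i a)
  rw [Fintype.piFinset_univ] at this
  rw [← this, ← Finset.mul_prod_erase _ _ (Finset.mem_univ j), Finset.prod_eq_one, mul_one]
  · simp
  · intro i hi
    simp [Finset.ne_of_mem_erase hi, hp1]

end TypicalProjector

theorem sub_kronecker {α β : Type} (X Y : Matrix α α ℂ) (Z : Matrix β β ℂ) :
    (X - Y) ⊗ₖ Z = X ⊗ₖ Z - Y ⊗ₖ Z := by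
  ext p q
  simp only [kroneckerMap_apply, Matrix.sub_apply, sub_mul]

theorem trace_submatrix_equiv {α β : Type} [Fintype α] [Fintype β] (X : Matrix α α ℂ)
    (f : β ≃ α) : (X.submatrix f f).trace = X.trace :=
  Equiv.sum_comp f fun i => X i i

/-! ### The false-alarm estimate for a bipartite system. -/

section Bipartite

variable {α β : Type} [Fintype α]

/-- The partial trace over the left factor. -/
def traceLeft (W : Matrix (α × β) (α × β) ℂ) : Matrix β β ℂ :=
  fun b b' => ∑ a, W (a, b) (a, b')

theorem traceLeft_posSemidef {W : Matrix (α × β) (α × β) ℂ} (hW : W.PosSemidef) :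
    (traceLeft W).PosSemidef := by
  have : traceLeft W = ∑ a, W.submatrix (fun b => (a, b)) (fun b => (a, b)) := by
    ext b b'
    simp [traceLeft, Matrix.sum_apply]
  rw [this]
  exact Matrix.posSemidef_sum _ fun a _ => hW.submatrix _

variable [Fintype β]

theorem trace_mul_one_kronecker [DecidableEq α] (W : Matrix (α × β) (α × β) ℂ)
    (Y : Matrix β β ℂ) :
    (W * ((1 : Matrix α α ℂ) ⊗ₖ Y)).trace = (traceLeft W * Y).trace := by
  simp only [Matrix.trace, Matrix.diag, Matrix.mul_apply, Fintype.sum_prod_type, traceLeft,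
    kroneckerMap_apply, Matrix.one_apply, Finset.sum_mul]
  simp only [ite_mul, one_mul, zero_mul, mul_ite, mul_zero]
  rw [Finset.sum_comm]
  refine Finset.sum_congr rfl fun b _ => ?_
  rw [Finset.sum_comm]
  conv_rhs => rw [Finset.sum_comm]
  rw [Finset.sum_comm]
  refine Finset.sum_congr rfl fun a _ => ?_
  rw [Finset.sum_comm]
  simp

/-- Cyclicity lets `Q ≤ 1` be used twice, against `m Q m` and then against `m²`, so `Q` and `m` need
not commute. This is where the purity `Tr m²`, hence `H₂`, enters. -/
theorem trace_sandwich_le [DecidableEq β] {m Q : Matrix β β ℂ} (hm : m.PosSemidef)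
    (hQ : Q.PosSemidef) (hQ1 : (1 - Q).PosSemidef) :
    (m * (Q * m * Q)).trace.re ≤ (m * m).trace.re := by
  have h1 := hQ.mul_mul_conjTranspose_same m
  have h2 := hm.mul_mul_conjTranspose_same m
  have h3 := Matrix.posSemidef_self_mul_conjTranspose m
  rw [hm.isHermitian.eq] at h1 h2 h3
  have e1 := trace_mul_re_mono hQ1 h1
  have e2 := trace_mul_re_mono hQ1 h3
  rw [Matrix.one_mul] at e1 e2
  calc (m * (Q * m * Q)).trace.re = (Q * (m * Q * m)).trace.re := by
        rw [← Matrix.mul_assoc, Matrix.trace_mul_comm, Matrix.mul_assoc]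
    _ ≤ (m * Q * m).trace.re := e1
    _ = (Q * (m * m)).trace.re := by rw [Matrix.mul_assoc, Matrix.trace_mul_comm, Matrix.mul_assoc]
    _ ≤ _ := e2

/-- The analytic core. Moving `QA ⊗ QB` by cyclicity onto the product state, `P ≤ c W` trades the
test for `W`, and `QA τ QA ≤ c'` trades the independent part for the identity. The trace of `W` over
`α` is then `m` again, and `trace_sandwich_le` disposes of `QB`. -/
theorem kronecker_test_bound [DecidableEq α] [DecidableEq β] {W P : Matrix (α × β) (α × β) ℂ}
    {QA τ : Matrix α α ℂ} {QB : Matrix β β ℂ} {c c' : ℝ} (hc : 0 ≤ c) (hc' : 0 ≤ c')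
    (hW : W.PosSemidef) (hPW : ((c : ℂ) • W - P).PosSemidef) (hτ : τ.PosSemidef)
    (hQA : QA.IsHermitian) (hQB : QB.PosSemidef) (hQB1 : (1 - QB).PosSemidef)
    (hA : ((c' : ℂ) • (1 : Matrix α α ℂ) - QA * τ * QA).PosSemidef) :
    (((QA ⊗ₖ QB) * P * (QA ⊗ₖ QB)) * (τ ⊗ₖ traceLeft W)).trace.re ≤
      c * c' * (traceLeft W * traceLeft W).trace.re := by
  have hm := traceLeft_posSemidef hW
  set m := traceLeft W with hmdef
  have hY : (QB * m * QB).PosSemidef := by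
    have := hm.mul_mul_conjTranspose_same QB
    rwa [hQB.isHermitian.eq] at this
  have hX : (QA * τ * QA).PosSemidef := by
    have := hτ.mul_mul_conjTranspose_same QA
    rwa [hQA.eq] at this
  have e0 : (((QA ⊗ₖ QB) * P * (QA ⊗ₖ QB)) * (τ ⊗ₖ m)).trace
      = (P * ((QA * τ * QA) ⊗ₖ (QB * m * QB))).trace := by
    rw [Matrix.mul_kronecker_mul, Matrix.mul_kronecker_mul, Matrix.mul_assoc, Matrix.mul_assoc,
      Matrix.trace_mul_comm]
    simp only [Matrix.mul_assoc]
  have e1 : (P * ((QA * τ * QA) ⊗ₖ (QB * m * QB))).trace.re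
      ≤ c * (W * ((QA * τ * QA) ⊗ₖ (QB * m * QB))).trace.re := by
    have := trace_mul_re_mono hPW (hX.kronecker hY)
    rwa [Matrix.smul_mul, Matrix.trace_smul, smul_eq_mul, Complex.re_ofReal_mul] at this
  have e2 : (W * ((QA * τ * QA) ⊗ₖ (QB * m * QB))).trace.re
      ≤ c' * (W * ((1 : Matrix α α ℂ) ⊗ₖ (QB * m * QB))).trace.re := by
    have h1 : ((((c' : ℂ) • (1 : Matrix α α ℂ)) ⊗ₖ (QB * m * QB))
        - ((QA * τ * QA) ⊗ₖ (QB * m * QB))).PosSemidef := by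
      rw [← sub_kronecker]
      exact hA.kronecker hY
    have := trace_mul_re_mono h1 hW
    rwa [Matrix.trace_mul_comm, Matrix.trace_mul_comm _ W, Matrix.smul_kronecker, Matrix.mul_smul,
      Matrix.trace_smul, smul_eq_mul, Complex.re_ofReal_mul] at this
  rw [trace_mul_one_kronecker] at e2
  have e3 := trace_sandwich_le hm hQB hQB1
  rw [e0]
  calc _ ≤ _ := e1
    _ ≤ c * (c' * (m * m).trace.re) := by gcongr; exact e2.trans (by gcongr)
    _ = _ := by ring

end Bipartite

/-! ### Separating the senders in `L` from the others. -/

section Split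

variable {K : ℕ} {Q : Fin K → Type} {D : Type}

/-- The senders outside `L` on the left; those in `L` and the channel output on the right. -/
def splitEquiv (Q : Fin K → Type) (D : Type) (L : Finset (Fin K)) :
    ((∀ k, Q k) × D) ≃ (∀ k : {k // k ∉ L}, Q k) × ((∀ k : {k // k ∈ L}, Q k) × D) :=
  (((Equiv.piEquivPiSubtypeProd (fun k => k ∈ L) Q).trans (Equiv.prodComm _ _)).prodCongr
    (Equiv.refl D)).trans (Equiv.prodAssoc _ _ _)

theorem piTensor_kronecker_one_split [DecidableEq D] (X : ∀ k, Matrix (Q k) (Q k) ℂ) (L : Finset (Fin K)) :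
    (piTensor X ⊗ₖ (1 : Matrix D D ℂ)) =
      ((piTensor fun k : {k // k ∉ L} => X k) ⊗ₖ
        ((piTensor fun k : {k // k ∈ L} => X k) ⊗ₖ (1 : Matrix D D ℂ))).submatrix
        (splitEquiv Q D L) (splitEquiv Q D L) := by
  ext ⟨p, d⟩ ⟨q, d'⟩
  simp only [kroneckerMap_apply, piTensor, submatrix_apply, splitEquiv, Equiv.trans_apply,
    Equiv.prodCongr_apply, Prod.map, Equiv.prodAssoc_apply, Equiv.prodComm_apply,
    Equiv.piEquivPiSubtypeProd_apply, Prod.swap, Equiv.refl_apply]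
  rw [← Fintype.prod_subtype_mul_prod_subtype (fun k => k ∈ L)]
  refine (congrArg (· * _) (mul_comm _ _)).trans ((mul_assoc _ _ _).trans ?_)
  congr!

variable [∀ k, Fintype (Q k)]

theorem traceLeft_split [∀ k, DecidableEq (Q k)] (W : Matrix ((∀ k, Q k) × D) ((∀ k, Q k) × D) ℂ)
    (L : Finset (Fin K)) :
    traceLeft (W.submatrix (splitEquiv Q D L).symm (splitEquiv Q D L).symm) = marginalSC W L :=
  rfl

/-- The receiver's operator when the senders outside `L` send independent copies of `τ`. -/
def partlyIndependent (τ : ∀ k, Matrix (Q k) (Q k) ℂ)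
    (W : Matrix ((∀ k, Q k) × D) ((∀ k, Q k) × D) ℂ) (L : Finset (Fin K)) :
    Matrix ((∀ k, Q k) × D) ((∀ k, Q k) × D) ℂ :=
  ((piTensor fun k : {k // k ∉ L} => τ k) ⊗ₖ marginalSC W L).submatrix
    (splitEquiv Q D L) (splitEquiv Q D L)

variable [Fintype D] [DecidableEq D] [∀ k, DecidableEq (Q k)]

theorem conjDiag_piTensor_le {J : Type} [Fintype J] [DecidableEq J] {κ : J → Type}
    [∀ j, Fintype (κ j)] [∀ j, DecidableEq (κ j)] {V : ∀ j, Matrix (κ j) (κ j) ℂ}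
    (hV : ∀ j, (V j)ᴴ * V j = 1) {d : ∀ j, κ j → ℝ} {c : J → ℝ} (hd : ∀ j x, 0 ≤ d j x)
    (hdc : ∀ j x, d j x ≤ c j) :
    (((∏ j, c j : ℝ) : ℂ) • 1 - piTensor fun j => conjDiag (V j) (d j)).PosSemidef := by
  have hV1 : (piTensor V)ᴴ * piTensor V = 1 := by
    rw [piTensor_conjTranspose, piTensor_mul]
    simp only [hV, piTensor_one]
  rw [piTensor_conjDiag, ← conjDiag_one (mul_eq_one_comm.mp hV1), smul_conjDiag, conjDiag_sub]
  refine conjDiag_posSemidef fun x => sub_nonneg.mpr ?_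
  rw [mul_one]
  exact Finset.prod_le_prod (fun j _ => hd _ _) fun j _ => hdc _ _

theorem piTensor_conjDiag_posSemidef {J : Type} [Fintype J] [DecidableEq J] {κ : J → Type}
    [∀ j, Fintype (κ j)] [∀ j, DecidableEq (κ j)] {V : ∀ j, Matrix (κ j) (κ j) ℂ}
    {d : ∀ j, κ j → ℝ} (hd : ∀ j x, 0 ≤ d j x) :
    (piTensor fun j => conjDiag (V j) (d j)).PosSemidef :=
  piTensor_posSemidef fun j => conjDiag_posSemidef (hd j)

theorem posSemidef_one_sub_kronecker_one {α β : Type} [Fintype α] [Fintype β] [DecidableEq α]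
    [DecidableEq β] {X : Matrix α α ℂ} (hX : (1 - X).PosSemidef) :
    (1 - X ⊗ₖ (1 : Matrix β β ℂ)).PosSemidef := by
  rw [← Matrix.one_kronecker_one, ← sub_kronecker]
  exact hX.kronecker PosSemidef.one

/-- The test `QPQ` rarely accepts when the senders outside `L` are independent of the output. -/
theorem test_bound {W P : Matrix ((∀ k, Q k) × D) ((∀ k, Q k) × D) ℂ}
    {V : ∀ k, Matrix (Q k) (Q k) ℂ} {q r : ∀ k, Q k → ℝ} {c : ℝ} {c' : Fin K → ℝ} (hc : 0 ≤ c)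
    (hW : W.PosSemidef) (hPW : ((c : ℂ) • W - P).PosSemidef) (hV : ∀ k, (V k)ᴴ * V k = 1)
    (hr : ∀ k x, 0 ≤ r k x) (hq : ∀ k x, q k x = 0 ∨ q k x = 1)
    (hqr : ∀ k x, q k x * r k x * q k x ≤ c' k) (hc' : ∀ k, 0 ≤ c' k) (L : Finset (Fin K)) :
    (((piTensor fun k => conjDiag (V k) (q k)) ⊗ₖ (1 : Matrix D D ℂ)) * P *
      ((piTensor fun k => conjDiag (V k) (q k)) ⊗ₖ (1 : Matrix D D ℂ)) *
      partlyIndependent (fun k => conjDiag (V k) (r k)) W L).trace.re ≤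
      c * (∏ k ∈ Lᶜ, c' k) * (marginalSC W L * marginalSC W L).trace.re := by
  have hq0 : ∀ k x, 0 ≤ q k x := fun k x => by rcases hq k x with h | h <;> simp [h]
  have hq1 : ∀ k x, q k x ≤ 1 := fun k x => by rcases hq k x with h | h <;> simp [h]
  set f := splitEquiv Q D L
  have hprod : ∏ k ∈ Lᶜ, c' k = ∏ k : {k // k ∉ L}, c' k :=
    Finset.prod_subtype _ (by simp) _
  have hP : P = (P.submatrix f.symm f.symm).submatrix f f := by simp
  -- The wrongly guessed senders form the left factor; the correctly guessed ones and the output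
  -- form the right factor, where the test projection acts trivially on the output.
  have key := kronecker_test_bound (W := W.submatrix f.symm f.symm)
    (P := P.submatrix f.symm f.symm) (QA := piTensor fun k : {k // k ∉ L} => conjDiag (V k) (q k))
    (τ := piTensor fun k : {k // k ∉ L} => conjDiag (V k) (r k))
    (QB := (piTensor fun k : {k // k ∈ L} => conjDiag (V k) (q k)) ⊗ₖ (1 : Matrix D D ℂ))
    (c := c) (c' := ∏ k ∈ Lᶜ, c' k) hc (Finset.prod_nonneg fun k _ => hc' k) (hW.submatrix _)
    (hPW.submatrix f.symm)
    (piTensor_conjDiag_posSemidef fun k : {k // k ∉ L} => hr k)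
    (piTensor_conjDiag_posSemidef fun k : {k // k ∉ L} => hq0 k).isHermitian
    ((piTensor_conjDiag_posSemidef fun k : {k // k ∈ L} => hq0 k).kronecker PosSemidef.one)
    (posSemidef_one_sub_kronecker_one (by
      have := conjDiag_piTensor_le (J := {k // k ∈ L}) (V := fun k => V k) (fun k => hV k)
        (d := fun k => q k) (c := fun _ => 1) (fun k => hq0 k) (fun k => hq1 k)
      simpa using this))
    (by
      rw [piTensor_mul, piTensor_mul, hprod]
      simp only [conjDiag_mul (hV _)]
      exact conjDiag_piTensor_le (fun k : {k // k ∉ L} => hV k)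
        (fun k x => mul_nonneg (mul_nonneg (hq0 _ _) (hr _ _)) (hq0 _ _)) (fun k x => hqr k x))
  rw [traceLeft_split] at key
  refine le_trans (le_of_eq ?_) key
  rw [piTensor_kronecker_one_split _ L, partlyIndependent]
  conv_lhs => rw [hP]
  rw [Matrix.submatrix_mul_equiv, Matrix.submatrix_mul_equiv, Matrix.submatrix_mul_equiv,
    trace_submatrix_equiv]

end Split

/-! ### Block powers, marginals and the memoryless channel. -/

section BlockPower

/-- Regroup `n` copies of the systems `S j` and of `C`. -/
def blockEquiv {J : Type} (S : J → Type) (C : Type) (n : ℕ) :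
    ((∀ j, Fin n → S j) × (Fin n → C)) ≃ (Fin n → (∀ j, S j) × C) where
  toFun p i := (fun j => p.1 j i, p.2 i)
  invFun p := (fun j i => (p i).1 j, fun i => (p i).2)
  left_inv _ := rfl
  right_inv _ := rfl

/-- `X^{⊗n}` for an operator on several systems `S j` and `C`, regrouped. -/
def blockPower {J : Type} {S : J → Type} {C : Type}
    (X : Matrix ((∀ j, S j) × C) ((∀ j, S j) × C) ℂ) (n : ℕ) :
    Matrix ((∀ j, Fin n → S j) × (Fin n → C)) ((∀ j, Fin n → S j) × (Fin n → C)) ℂ :=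
  (piTensor fun _ : Fin n => X).submatrix (blockEquiv S C n) (blockEquiv S C n)

/-- `X^{⊗n}` for a bipartite operator, regrouped. -/
def pairPower {S A : Type} (X : Matrix (S × A) (S × A) ℂ) (n : ℕ) :
    Matrix ((Fin n → S) × (Fin n → A)) ((Fin n → S) × (Fin n → A)) ℂ :=
  (piTensor fun _ : Fin n => X).submatrix (Equiv.arrowProdEquivProdArrow _ _ _).symm
    (Equiv.arrowProdEquivProdArrow _ _ _).symm

theorem isState_submatrix_equiv {α β : Type} [Fintype α] [Fintype β] {ρ : Matrix α α ℂ}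
    (hρ : IsState ρ) (e : β ≃ α) : IsState (ρ.submatrix e e) :=
  ⟨hρ.1.submatrix e, (trace_submatrix_equiv ρ e).trans hρ.2⟩

theorem pairPower_isState {S A : Type} [Fintype S] [Fintype A] {X : Matrix (S × A) (S × A) ℂ}
    (hX : IsState X) (n : ℕ) : IsState (pairPower X n) :=
  isState_submatrix_equiv (piTensor_isState fun _ => hX) _

theorem blockPower_isState {J : Type} [Fintype J] [DecidableEq J] {S : J → Type} {C : Type}
    [∀ j, Fintype (S j)] [Fintype C] {X : Matrix ((∀ j, S j) × C) ((∀ j, S j) × C) ℂ}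
    (hX : IsState X) (n : ℕ) : IsState (blockPower X n) :=
  isState_submatrix_equiv (piTensor_isState fun _ => hX) _

theorem blockPower_trace_sq {J : Type} [Fintype J] [DecidableEq J] {S : J → Type} {C : Type}
    [∀ j, Fintype (S j)] [Fintype C] (X : Matrix ((∀ j, S j) × C) ((∀ j, S j) × C) ℂ) (n : ℕ) :
    (blockPower X n * blockPower X n).trace = (X * X).trace ^ n := by
  rw [blockPower, Matrix.submatrix_mul_equiv, trace_submatrix_equiv, piTensor_mul, piTensor_trace,
    Finset.prod_const, Finset.card_univ, Fintype.card_fin]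

theorem map_apply_eq_sum {A C : Type} [Fintype A] [DecidableEq A]
    (N : Matrix A A ℂ →ₗ[ℂ] Matrix C C ℂ) (X : Matrix A A ℂ) (c c' : C) :
    N X c c' = ∑ a, ∑ a', X a a' * N (Matrix.single a a' 1) c c' := by
  conv_lhs => rw [Matrix.matrix_eq_sum_single X]
  simp only [map_sum, Matrix.sum_apply]
  refine Finset.sum_congr rfl fun a _ => Finset.sum_congr rfl fun a' _ => ?_
  rw [show Matrix.single a a' (X a a') = X a a' • Matrix.single a a' (1 : ℂ) by simp,
    map_smul, Matrix.smul_apply, smul_eq_mul]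

theorem prod_sum_fin {α : Type} [Fintype α] {n : ℕ} (F : Fin n → α → ℂ) :
    ∏ i, ∑ a, F i a = ∑ x : Fin n → α, ∏ i, F i (x i) := by
  classical
  rw [Finset.prod_univ_sum, Fintype.piFinset_univ]

variable {K : ℕ} {A S : Fin K → Type} {C : Type}

/-- Expand each use of `N` in matrix units and exchange product and sum. This makes the block
problem i.i.d., so typicality applies to `ω^{⊗n}`. -/
theorem ampliate_tensorPower [∀ k, Fintype (A k)] [∀ k, DecidableEq (A k)]
    (N : Matrix (∀ k, A k) (∀ k, A k) ℂ →ₗ[ℂ] Matrix C C ℂ)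
    (θ : ∀ k, Matrix (S k × A k) (S k × A k) ℂ) (n : ℕ) :
    ampliate (tensorPower N n) (tensorPairs fun k => pairPower (θ k) n) =
      blockPower (ampliate N (tensorPairs θ)) n := by
  ext ⟨s, c⟩ ⟨s', c'⟩
  simp only [ampliate, tensorPower, blockPower, piTensor, Matrix.submatrix_apply, blockEquiv,
    Equiv.coe_fn_mk, LinearMap.coe_mk, AddHom.coe_mk, Matrix.of_apply]
  simp only [map_apply_eq_sum N (fun a a' => tensorPairs θ _ _)]
  rw [prod_sum_fin]
  simp only [prod_sum_fin]
  refine Fintype.sum_equiv (Equiv.piComm _) _ _ fun a => Fintype.sum_equiv (Equiv.piComm _) _ _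
    fun a' => ?_
  rw [Finset.prod_mul_distrib]
  congr 1
  simp only [tensorPairs, pairPower, piTensor, Matrix.submatrix_apply]
  rw [Finset.prod_comm]
  rfl

theorem marginalSC_blockPower [∀ k, Fintype (S k)]
    (ω : Matrix ((∀ k, S k) × C) ((∀ k, S k) × C) ℂ) (L : Finset (Fin K)) (n : ℕ) :
    marginalSC (blockPower ω n) L = blockPower (marginalSC ω L) n := by
  ext ⟨s, c⟩ ⟨s', c'⟩
  simp only [marginalSC, blockPower, piTensor, Matrix.submatrix_apply]
  rw [prod_sum_fin]
  refine Fintype.sum_equiv (Equiv.piComm _) _ _ fun t => Finset.prod_congr rfl fun i _ => ?_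
  congr 1
  · refine Prod.ext (funext fun k => ?_) rfl
    simp only [blockEquiv, Equiv.coe_fn_mk, Equiv.piEquivPiSubtypeProd_symm_apply]
    split_ifs <;> rfl
  · refine Prod.ext (funext fun k => ?_) rfl
    simp only [blockEquiv, Equiv.coe_fn_mk, Equiv.piEquivPiSubtypeProd_symm_apply]
    split_ifs <;> rfl

/-- The partial trace over the right factor. -/
def traceRight {α β : Type} [Fintype β] (W : Matrix (α × β) (α × β) ℂ) : Matrix α α ℂ :=
  fun a a' => ∑ b, W (a, b) (a', b)

theorem traceRight_isState {α β : Type} [Fintype α] [Fintype β] {W : Matrix (α × β) (α × β) ℂ}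
    (hW : IsState W) : IsState (traceRight W) := by
  refine ⟨?_, ?_⟩
  · have : traceRight W = ∑ b, W.submatrix (fun a => (a, b)) (fun a => (a, b)) := by
      ext a a'
      simp [traceRight, Matrix.sum_apply]
    rw [this]
    exact Matrix.posSemidef_sum _ fun a _ => hW.1.submatrix _
  · rw [← hW.2, Matrix.trace, Matrix.trace, Fintype.sum_prod_type]
    rfl

theorem traceLeft_isState {α β : Type} [Fintype α] [Fintype β] {W : Matrix (α × β) (α × β) ℂ}
    (hW : IsState W) : IsState (traceLeft W) := by
  refine ⟨traceLeft_posSemidef hW.1, ?_⟩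
  rw [← hW.2, Matrix.trace, Matrix.trace, Fintype.sum_prod_type_right]
  rfl

theorem marginalSC_isState [∀ k, Fintype (S k)] [Fintype C]
    {ω : Matrix ((∀ k, S k) × C) ((∀ k, S k) × C) ℂ} (hω : IsState ω) (L : Finset (Fin K)) :
    IsState (marginalSC ω L) :=
  traceLeft_isState (isState_submatrix_equiv hω (splitEquiv S C L).symm)

theorem IsState.trace_sq_pos {α : Type} [Fintype α] {ρ : Matrix α α ℂ} (hρ : IsState ρ) :
    0 < (ρ * ρ).trace.re := by
  have h0 := trace_mul_re_nonneg hρ.1 hρ.1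
  refine lt_of_le_of_ne h0 fun h => ?_
  have h1 := (Matrix.posSemidef_conjTranspose_mul_self ρ).trace_nonneg
  have h2 : (ρᴴ * ρ).trace = 0 := by
    refine Complex.ext ?_ ?_
    · rw [hρ.1.isHermitian.eq]
      exact h.symm
    · exact (Complex.le_def.mp h1).2.symm
  have h3 := Matrix.trace_conjTranspose_mul_self_eq_zero_iff.mp h2
  have h4 := hρ.2
  rw [h3, Matrix.trace_zero] at h4
  exact zero_ne_one h4

theorem tensorPairs_isState [∀ k, Fintype (A k)] [∀ k, Fintype (S k)]
    {θ : ∀ k, Matrix (S k × A k) (S k × A k) ℂ} (hθ : ∀ k, IsState (θ k)) :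
    IsState (tensorPairs θ) :=
  isState_submatrix_equiv (piTensor_isState hθ)
    { toFun := fun p k => (p.1 k, p.2 k)
      invFun := fun p => (fun k => (p k).1, fun k => (p k).2)
      left_inv := fun _ => rfl
      right_inv := fun _ => rfl }

theorem IsChannel.ampliate_isState {A B R : Type} [Fintype A] [Fintype B] [Fintype R]
    {Φ : Matrix A A ℂ →ₗ[ℂ] Matrix B B ℂ} (hΦ : IsChannel Φ) {X : Matrix (R × A) (R × A) ℂ}
    (hX : IsState X) : IsState (ampliate Φ X) := by
  refine ⟨hΦ.completelyPositive R X hX.1, ?_⟩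
  rw [← hX.2, Matrix.trace, Matrix.trace, Fintype.sum_prod_type, Fintype.sum_prod_type]
  exact Finset.sum_congr rfl fun r _ =>
    hΦ.tracePreserving (fun a a' => X (r, a) (r, a'))

/-- Discarding the output undoes the channel by trace preservation, so the reference systems keep
their original product state. Additivity of `H(S(J))` rests on this. -/
theorem traceRight_ampliate [∀ k, Fintype (A k)] [Fintype C]
    {N : Matrix (∀ k, A k) (∀ k, A k) ℂ →ₗ[ℂ] Matrix C C ℂ} (hN : IsChannel N)
    (θ : ∀ k, Matrix (S k × A k) (S k × A k) ℂ) :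
    traceRight (ampliate N (tensorPairs θ)) = piTensor fun k => traceRight (θ k) := by
  ext s s'
  refine (hN.tracePreserving (fun a a' => tensorPairs θ (s, a) (s', a'))).trans ?_
  simp only [Matrix.trace, Matrix.diag, tensorPairs, piTensor, traceRight]
  rw [Finset.prod_univ_sum, Fintype.piFinset_univ]

theorem traceRight_blockPower [Fintype C] {ω : Matrix ((∀ k, S k) × C) ((∀ k, S k) × C) ℂ}
    {τ : ∀ k, Matrix (S k) (S k) ℂ} (h : traceRight ω = piTensor τ) (n : ℕ) :
    traceRight (blockPower ω n) = piTensor fun k => piTensor fun _ : Fin n => τ k := by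
  ext s s'
  simp only [traceRight, blockPower, piTensor, Matrix.submatrix_apply, blockEquiv,
    Equiv.coe_fn_mk]
  rw [← prod_sum_fin (fun i c => ω (fun j => s j i, c) (fun j => s' j i, c)), Finset.prod_comm]
  refine Finset.prod_congr rfl fun i _ => ?_
  exact congrFun (congrFun h (fun k => s k i)) (fun k => s' k i)

theorem marginalS_eq_piTensor [∀ k, Fintype (S k)] [Fintype C]
    {ω : Matrix ((∀ k, S k) × C) ((∀ k, S k) × C) ℂ} {τ : ∀ k, Matrix (S k) (S k) ℂ}
    (h : traceRight ω = piTensor τ) (hτ : ∀ k, (τ k).trace = 1) (J : Finset (Fin K)) :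
    marginalS ω J = piTensor fun k : {k // k ∈ J} => τ k := by
  ext s s'
  simp only [marginalS, marginalSC]
  rw [Finset.sum_comm]
  have h1 : ∀ t : (∀ k : {k // k ∉ J}, S k),
      ∑ c, ω ((Equiv.piEquivPiSubtypeProd (fun k => k ∈ J) S).symm (s, t), c)
        ((Equiv.piEquivPiSubtypeProd (fun k => k ∈ J) S).symm (s', t), c)
      = (∏ k : {k // k ∈ J}, τ k (s k) (s' k)) * ∏ k : {k // k ∉ J}, τ k (t k) (t k) := by
    intro t
    refine (congrFun (congrFun h _) _).trans ?_
    simp only [piTensor, Equiv.piEquivPiSubtypeProd_symm_apply]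
    rw [← Fintype.prod_subtype_mul_prod_subtype (fun k => k ∈ J)]
    congr 1
    · exact Finset.prod_congr (by ext; simp) fun k _ => by simp [k.2]
    · exact Finset.prod_congr rfl fun k _ => by simp [k.2]
  have h2 := Finset.prod_univ_sum (fun k : {k // k ∉ J} => (Finset.univ : Finset (S k)))
    (fun k x => τ k x x)
  rw [Fintype.piFinset_univ] at h2
  have h3 : ∏ k : {k // k ∉ J}, ∑ x, τ k x x = 1 := Finset.prod_eq_one fun k _ => hτ k
  rw [Finset.sum_congr rfl fun t _ => h1 t, ← Finset.mul_sum, ← h2, h3, mul_one]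
  rfl

end BlockPower

/-! ### Tests at a tuple of register positions. -/

section Positions

variable {K : ℕ} {M : Fin K → ℕ} {Q : Fin K → Type} {D : Type}

/-- `X` on the registers number `m 1, …, m K` and on `D`, tensored with `Y k` on every other
register of sender `k`. -/
def atPositions (X : Matrix ((∀ k, Q k) × D) ((∀ k, Q k) × D) ℂ) (Y : ∀ k, Matrix (Q k) (Q k) ℂ)
    (m : ∀ k, Fin (M k)) :
    Matrix ((∀ k, Fin (M k) → Q k) × D) ((∀ k, Fin (M k) → Q k) × D) ℂ :=
  fun p q => X (fun k => p.1 k (m k), p.2) (fun k => q.1 k (m k), q.2) *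
    ∏ k, ∏ i, if i = m k then 1 else Y k (p.1 k i) (q.1 k i)

/-- The missing factors at the selected registers are filled by the all-ones matrix, which is
positive. The operator is then a compression of a Kronecker product along a map that reads the
selected registers twice. -/
theorem atPositions_posSemidef [∀ k, Fintype (Q k)] [Fintype D]
    {X : Matrix ((∀ k, Q k) × D) ((∀ k, Q k) × D) ℂ}
    {Y : ∀ k, Matrix (Q k) (Q k) ℂ} (hX : X.PosSemidef) (hY : ∀ k, (Y k).PosSemidef)
    (m : ∀ k, Fin (M k)) : (atPositions X Y m).PosSemidef := by
  have h1 : (piTensor fun k => piTensor fun i : Fin (M k) =>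
      if i = m k then vecMulVec 1 (star 1) else Y k).PosSemidef :=
    piTensor_posSemidef fun k => piTensor_posSemidef fun i => by
      split_ifs
      · exact posSemidef_vecMulVec_self_star _
      · exact hY k
  have h2 : atPositions X Y m = (X ⊗ₖ piTensor fun k => piTensor fun i : Fin (M k) =>
      if i = m k then vecMulVec 1 (star 1) else Y k).submatrix
      (fun p => ((fun k => p.1 k (m k), p.2), p.1))
      (fun p => ((fun k => p.1 k (m k), p.2), p.1)) := by
    ext p q
    simp only [atPositions, submatrix_apply, kroneckerMap_apply, piTensor]
    congr 1
    refine Finset.prod_congr rfl fun k _ => Finset.prod_congr rfl fun i _ => ?_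
    split_ifs <;> simp [vecMulVec_apply]
  rw [h2]
  exact (hX.kronecker h1).submatrix _

theorem checkOp_eq_atPositions [∀ k, DecidableEq (Q k)]
    (T : Matrix ((∀ k, Q k) × D) ((∀ k, Q k) × D) ℂ) (m : ∀ k, Fin (M k)) :
    checkOp T m = atPositions T (fun _ => 1) m := by
  ext p q
  simp only [checkOp, atPositions]
  split_ifs with h
  · rw [Finset.prod_eq_one, mul_one]
    intro k _
    refine Finset.prod_eq_one fun i _ => ?_
    split_ifs with hi
    · rfl
    · rw [h k i hi, one_apply_eq]
  · push Not at h
    obtain ⟨k, i, hi, hne⟩ := h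
    rw [Finset.prod_eq_zero (Finset.mem_univ k), mul_zero]
    refine Finset.prod_eq_zero (Finset.mem_univ i) ?_
    rw [if_neg hi, one_apply_ne hne]

theorem checkOp_one [∀ k, DecidableEq (Q k)] [DecidableEq D] (m : ∀ k, Fin (M k)) :
    checkOp (1 : Matrix ((∀ k, Q k) × D) ((∀ k, Q k) × D) ℂ) m = 1 := by
  ext ⟨p, d⟩ ⟨q, d'⟩
  simp only [checkOp, one_apply, Prod.mk.injEq]
  by_cases h : p = q ∧ d = d'
  · obtain ⟨rfl, rfl⟩ := h
    simp
  · rw [if_neg h]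
    split_ifs with h1 h2
    · refine absurd ⟨?_, h2.2⟩ h
      funext k i
      by_cases hi : i = m k
      · subst hi
        exact congrFun h2.1 k
      · exact h1 k i hi
    · rfl
    · rfl

theorem checkOp_sub [∀ k, DecidableEq (Q k)]
    (T T' : Matrix ((∀ k, Q k) × D) ((∀ k, Q k) × D) ℂ) (m : ∀ k, Fin (M k)) :
    checkOp (T - T') m = checkOp T m - checkOp T' m := by
  ext p q
  simp only [checkOp, Matrix.sub_apply]
  split_ifs <;> simp

theorem checkOp_posSemidef [∀ k, Fintype (Q k)] [Fintype D] [∀ k, DecidableEq (Q k)]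
    {T : Matrix ((∀ k, Q k) × D) ((∀ k, Q k) × D) ℂ} (hT : T.PosSemidef)
    (m : ∀ k, Fin (M k)) : (checkOp T m).PosSemidef := by
  rw [checkOp_eq_atPositions]
  exact atPositions_posSemidef hT (fun _ => PosSemidef.one) m

/-- Two sums of a function of a tuple against product weights agree if the push-forwards of the
weights agree. -/
theorem sum_mul_prod_eq_of_pushforward {P P' Z : Fin K → Type} [∀ k, Fintype (P k)]
    [∀ k, Fintype (P' k)] [∀ k, Fintype (Z k)] [∀ k, DecidableEq (Z k)] (φ : ∀ k, P k → Z k)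
    (φ' : ∀ k, P' k → Z k) (f : ∀ k, P k → ℂ) (f' : ∀ k, P' k → ℂ)
    (h : ∀ k z, (∑ u, if φ k u = z then f k u else 0) = ∑ u, if φ' k u = z then f' k u else 0)
    (G : (∀ k, Z k) → ℂ) :
    ∑ p : ∀ k, P k, G (fun k => φ k (p k)) * ∏ k, f k (p k) =
      ∑ p : ∀ k, P' k, G (fun k => φ' k (p k)) * ∏ k, f' k (p k) := by
  have key : ∀ {P : Fin K → Type} [∀ k, Fintype (P k)] (φ : ∀ k, P k → Z k) (f : ∀ k, P k → ℂ),
      ∑ p : ∀ k, P k, G (fun k => φ k (p k)) * ∏ k, f k (p k) =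
        ∑ z, G z * ∏ k, ∑ u, if φ k u = z k then f k u else 0 := by
    intro P _ φ f
    have h1 : ∀ z : ∀ k, Z k, (∏ k, ∑ u, if φ k u = z k then f k u else 0)
        = ∑ p : ∀ k, P k, ∏ k, if φ k (p k) = z k then f k (p k) else 0 := by
      intro z
      rw [Finset.prod_univ_sum, Fintype.piFinset_univ]
    simp only [h1, Finset.mul_sum]
    rw [Finset.sum_comm]
    refine Finset.sum_congr rfl fun p _ => ?_
    rw [Finset.sum_eq_single (fun k => φ k (p k))]
    · simp
    · intro z _ hz
      obtain ⟨k, hk⟩ := Function.ne_iff.mp hz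
      rw [Finset.prod_eq_zero (Finset.mem_univ k), mul_zero]
      rw [if_neg fun hh => hk hh.symm]
    · simp
  rw [key, key]
  simp only [h]

/-- One sender's share of the trace: `b` is the tested register, `a` the transmitted one, and `z`
lists the row and column indices that `T` and `W` see. If `a = b` the indices are tied together; if
not, `a` is traced out and `b` carries `τ`. Every other register contributes `Tr τ = 1`. -/
theorem register_pushforward {ι R : Type} [Fintype ι] [DecidableEq ι] [Fintype R] [DecidableEq R]
    {τ : Matrix R R ℂ} (hτ : τ.trace = 1) (a b : ι) (z : R × R × R × R) :
    (∑ w : (ι → R) × (ι → R), if (w.1 b, w.2 b, w.2 a, w.1 a) = z then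
      ∏ i, (if i = b then 1 else (1 : Matrix R R ℂ) (w.1 i) (w.2 i)) *
        (if i = a then 1 else τ (w.2 i) (w.1 i)) else 0) =
    if a = b then (if z.1 = z.2.2.2 ∧ z.2.1 = z.2.2.1 then 1 else 0)
      else (if z.2.2.1 = z.2.2.2 then τ z.2.1 z.1 else 0) := by
  obtain ⟨y, y', x, x'⟩ := z
  -- The constraint fixing `z` is absorbed into factors local to `a` and `b`, so the whole sum
  -- factorizes over registers.
  set F : ι → R → R → ℂ := fun i u v =>
    ((if i = b then 1 else (1 : Matrix R R ℂ) u v) * (if i = a then 1 else τ v u)) *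
      ((if i = b then (if u = y ∧ v = y' then 1 else 0) else 1) *
        (if i = a then (if v = x ∧ u = x' then 1 else 0) else 1)) with hF
  have h1 : ∀ w : (ι → R) × (ι → R), (if (w.1 b, w.2 b, w.2 a, w.1 a) = (y, y', x, x') then
      ∏ i, (if i = b then 1 else (1 : Matrix R R ℂ) (w.1 i) (w.2 i)) *
        (if i = a then 1 else τ (w.2 i) (w.1 i)) else 0) = ∏ i, F i (w.1 i) (w.2 i) := by
    intro w
    simp only [hF]
    simp only [Finset.prod_mul_distrib, Finset.prod_ite_eq', Finset.mem_univ, if_true,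
      Prod.mk.injEq]
    by_cases e1 : w.1 b = y ∧ w.2 b = y'
    · by_cases e2 : w.2 a = x ∧ w.1 a = x'
      · simp [e1, e2]
      · rw [if_neg, if_neg e2]
        · simp
        · tauto
    · rw [if_neg, if_neg e1]
      · simp
      · tauto
  rw [Finset.sum_congr rfl fun w _ => h1 w, Fintype.sum_prod_type]
  have h2 : ∑ u : ι → R, ∑ v : ι → R, ∏ i, F i (u i) (v i) = ∏ i, ∑ u, ∑ v, F i u v := by
    simp only [Finset.prod_univ_sum, Fintype.piFinset_univ]
  rw [h2]
  have hrest : ∀ i, i ≠ a → i ≠ b → ∑ u, ∑ v, F i u v = 1 := by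
    intro i hia hib
    simp only [hF, if_neg hia, if_neg hib, one_apply]
    simpa [Matrix.trace] using hτ
  by_cases hab : a = b
  · subst hab
    rw [Fintype.prod_eq_single a fun i hi => hrest i hi hi, if_pos rfl]
    simp only [hF, if_true]
    rw [Finset.sum_eq_single y, Finset.sum_eq_single y']
    · by_cases e1 : y = x' <;> by_cases e2 : y' = x <;> simp [e1, e2]
    · intro v _ hv
      simp [hv]
    · simp
    · intro u _ hu
      simp [hu]
    · simp
  · rw [Fintype.prod_eq_mul a b hab fun i hi => hrest i hi.1 hi.2, if_neg hab]
    have ha : ∑ u, ∑ v, F a u v = if x = x' then 1 else 0 := by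
      simp only [hF, if_neg hab, if_true]
      rw [Finset.sum_eq_single x', Finset.sum_eq_single x]
      · simp [one_apply, eq_comm]
      · intro v _ hv
        simp [hv]
      · simp
      · intro u _ hu
        simp [hu]
      · simp
    have hb : ∑ u, ∑ v, F b u v = τ y' y := by
      simp only [hF, if_neg (Ne.symm hab), if_true]
      rw [Finset.sum_eq_single y, Finset.sum_eq_single y']
      · simp
      · intro v _ hv
        simp [hv]
      · simp
      · intro u _ hu
        simp [hu]
      · simp
    rw [ha, hb]
    split_ifs <;> simp

/-- The same push-forward from the parametrization used in `partlyIndependent_apply`; agreement with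
`register_pushforward` identifies the two traces. -/
theorem triple_pushforward {R : Type} [Fintype R] [DecidableEq R] (τ : Matrix R R ℂ) (c : Prop)
    [Decidable c] (z : R × R × R × R) :
    (∑ w : (R × R) × R, if ((w.1.1, w.1.2, if c then (w.1.2, w.1.1) else (w.2, w.2)) :
        R × R × R × R) = z then
      (if c then (if w.2 = w.1.1 then 1 else 0) else τ w.1.2 w.1.1) else 0) =
    if c then (if z.1 = z.2.2.2 ∧ z.2.1 = z.2.2.1 then 1 else 0)
      else (if z.2.2.1 = z.2.2.2 then τ z.2.1 z.1 else 0) := by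
  obtain ⟨y, y', x, x'⟩ := z
  rw [Finset.sum_eq_single ((y, y'), x')]
  · by_cases hc : c
    · simp only [if_pos hc, Prod.mk.injEq, true_and]
      by_cases e1 : y = x' <;> by_cases e2 : y' = x <;> simp [e1, e2]
    · simp [if_neg hc, eq_comm]
  · rintro ⟨⟨u, v⟩, t⟩ _ hne
    by_cases hc : c
    · simp only [if_pos hc, Prod.mk.injEq]
      split_ifs with h1 h2
      · refine absurd ?_ hne
        simp only [Prod.mk.injEq]
        exact ⟨⟨h1.1, h1.2.1⟩, h2.trans h1.2.2.2⟩
      · rfl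
      · rfl
    · simp only [if_neg hc, Prod.mk.injEq]
      rw [if_neg]
      rintro ⟨h1, h2, h3, h4⟩
      exact hne (by simp [h1, h2, h4])
  · simp

theorem sum_pi_prod {P P' : Fin K → Type} [∀ k, Fintype (P k)] [∀ k, Fintype (P' k)]
    (F : (∀ k, P k) → (∀ k, P' k) → ℂ) :
    ∑ p, ∑ q, F p q = ∑ w : ∀ k, P k × P' k, F (fun k => (w k).1) (fun k => (w k).2) := by
  rw [← Fintype.sum_prod_type']
  exact Fintype.sum_equiv (Equiv.arrowProdEquivProdArrow _ _ _).symm _ _ fun _ => rfl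

theorem trace_mul_pi_prod {P : Fin K → Type} [∀ k, Fintype (P k)] [Fintype D]
    (X Y : Matrix ((∀ k, P k) × D) ((∀ k, P k) × D) ℂ) :
    (X * Y).trace = ∑ d, ∑ d', ∑ w : ∀ k, P k × P k,
      X (fun k => (w k).1, d) (fun k => (w k).2, d') *
        Y (fun k => (w k).2, d') (fun k => (w k).1, d) := by
  simp only [Matrix.trace, Matrix.diag, Matrix.mul_apply]
  rw [Fintype.sum_prod_type_right]
  refine Finset.sum_congr rfl fun d _ => ?_
  simp only [Fintype.sum_prod_type_right]
  rw [Finset.sum_comm]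
  refine Finset.sum_congr rfl fun d' _ => ?_
  rw [sum_pi_prod fun p q => X (p, d) (q, d') * Y (q, d') (p, d)]

variable [∀ k, Fintype (Q k)] [∀ k, DecidableEq (Q k)]

/-- The partial trace becomes a sum over full tuples, with dummy entries pinned for senders in `L`.
The weight is then a product over senders, as `sum_mul_prod_eq_of_pushforward` requires. -/
theorem partlyIndependent_apply (τ : ∀ k, Matrix (Q k) (Q k) ℂ)
    (W : Matrix ((∀ k, Q k) × D) ((∀ k, Q k) × D) ℂ) (L : Finset (Fin K)) (y y' : ∀ k, Q k)
    (d d' : D) :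
    partlyIndependent τ W L (y', d') (y, d) =
      ∑ t : ∀ k, Q k, W (fun k => if k ∈ L then y' k else t k, d')
        (fun k => if k ∈ L then y k else t k, d) *
        ∏ k, if k ∈ L then (if t k = y k then 1 else 0) else τ k (y' k) (y k) := by
  rw [← Equiv.sum_comp (Equiv.piEquivPiSubtypeProd (fun k => k ∈ L) Q).symm,
    Fintype.sum_prod_type]
  refine Eq.trans ?_ (Finset.sum_eq_single (fun k : {k // k ∈ L} => y k) ?_ ?_).symm
  · simp only [partlyIndependent, submatrix_apply, kroneckerMap_apply, marginalSC, Finset.mul_sum]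
    refine Finset.sum_congr rfl fun t _ => ?_
    rw [mul_comm]
    congr 1
    · congr 1
      · refine Prod.ext (funext fun k => ?_) rfl
        simp only [Equiv.piEquivPiSubtypeProd_symm_apply]
        split_ifs <;> rfl
      · refine Prod.ext (funext fun k => ?_) rfl
        simp only [Equiv.piEquivPiSubtypeProd_symm_apply]
        split_ifs <;> rfl
    · rw [← Fintype.prod_subtype_mul_prod_subtype (fun k => k ∈ L), Finset.prod_eq_one, one_mul]
      · refine Finset.prod_congr (by ext; simp) fun k _ => ?_
        rw [if_neg k.2]
        rfl
      · rintro ⟨k, hk⟩ _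
        simp [hk]
  · intro u _ hu
    obtain ⟨k, hk⟩ := Function.ne_iff.mp hu
    refine Finset.sum_eq_zero fun t _ => ?_
    rw [Finset.prod_eq_zero (Finset.mem_univ (k : Fin K)), mul_zero]
    rw [if_pos k.2, if_neg]
    simpa using hk
  · simp

/-- Once the entries of `T` and `W` are fixed, the remaining weight factorizes over senders, so it
suffices to compare push-forwards one sender at a time. The outcome depends on `m` and `m'` only
through the set where they agree. -/
theorem trace_checkOp_mul_atPositions [Fintype D] {τ : ∀ k, Matrix (Q k) (Q k) ℂ}
    (hτ : ∀ k, (τ k).trace = 1) (T W : Matrix ((∀ k, Q k) × D) ((∀ k, Q k) × D) ℂ)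
    (m m' : ∀ k, Fin (M k)) :
    (checkOp T m' * atPositions W τ m).trace =
      (T * partlyIndependent τ W (Finset.univ.filter fun k => m k = m' k)).trace := by
  set L := Finset.univ.filter fun k => m k = m' k with hL
  have hmem : ∀ k, k ∈ L ↔ m k = m' k := by simp [hL]
  rw [checkOp_eq_atPositions, trace_mul_pi_prod, trace_mul_pi_prod]
  refine Finset.sum_congr rfl fun d _ => Finset.sum_congr rfl fun d' _ => ?_
  have key := sum_mul_prod_eq_of_pushforward
    (φ := fun k (w : (Fin (M k) → Q k) × (Fin (M k) → Q k)) =>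
      (w.1 (m' k), w.2 (m' k), w.2 (m k), w.1 (m k)))
    (φ' := fun k (w : (Q k × Q k) × Q k) =>
      ((w.1.1, w.1.2, if k ∈ L then (w.1.2, w.1.1) else (w.2, w.2)) : Q k × Q k × Q k × Q k))
    (f := fun k w => ∏ i, (if i = m' k then 1 else (1 : Matrix (Q k) (Q k) ℂ) (w.1 i) (w.2 i)) *
        (if i = m k then 1 else τ k (w.2 i) (w.1 i)))
    (f' := fun k w => if k ∈ L then (if w.2 = w.1.1 then 1 else 0) else τ k w.1.2 w.1.1)
    (fun k z => by
      rw [register_pushforward (hτ k), triple_pushforward]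
      simp only [hmem])
    (fun z => T (fun k => (z k).1, d) (fun k => (z k).2.1, d') *
      W (fun k => (z k).2.2.1, d') (fun k => (z k).2.2.2, d))
  refine Eq.trans (Finset.sum_congr rfl fun w _ => ?_) (key.trans ?_)
  · simp only [atPositions, Finset.prod_mul_distrib]
    ring
  · simp only [partlyIndependent_apply, Finset.mul_sum]
    rw [sum_pi_prod fun (w : ∀ k, Q k × Q k) (t : ∀ k, Q k) => _]
    refine Finset.sum_congr rfl fun v _ => ?_
    rw [mul_assoc]
    congr 3
    · refine Prod.ext (funext fun k => ?_) rfl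
      dsimp only
      split_ifs <;> rfl
    · refine Prod.ext (funext fun k => ?_) rfl
      dsimp only
      split_ifs <;> rfl

end Positions

/-! ### The encoder: keep one register. -/

section Encoder

/-- The partial trace of all registers but the one with number `m`. -/
def keepRegister {M : ℕ} {B : Type} [Fintype B] (m : Fin M) :
    Matrix (Fin M → B) (Fin M → B) ℂ →ₗ[ℂ] Matrix B B ℂ where
  toFun X := Matrix.of fun b b' => ∑ t, X ((Equiv.funSplitAt m B).symm (b, t))
    ((Equiv.funSplitAt m B).symm (b', t))
  map_add' X Y := by
    ext b b'
    simp only [Matrix.add_apply, Matrix.of_apply, Finset.sum_add_distrib]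
  map_smul' z X := by
    ext b b'
    simp only [Matrix.smul_apply, Matrix.of_apply, Finset.smul_sum, RingHom.id_apply]

theorem keepRegister_isChannel {M : ℕ} {B : Type} [Fintype B] (m : Fin M) :
    IsChannel (keepRegister (B := B) m) := by
  refine ⟨fun R _ X hX => ?_, fun X => ?_⟩
  · have : ampliate (keepRegister m) X = ∑ t, X.submatrix
        (fun p : R × B => (p.1, (Equiv.funSplitAt m B).symm (p.2, t)))
        (fun p : R × B => (p.1, (Equiv.funSplitAt m B).symm (p.2, t))) := by
      ext p q
      simp only [Matrix.sum_apply, Matrix.submatrix_apply]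
      rfl
    rw [this]
    exact Matrix.posSemidef_sum _ fun t _ => hX.submatrix _
  · rw [Matrix.trace, Matrix.trace, ← Equiv.sum_comp (Equiv.funSplitAt m B).symm,
      Fintype.sum_prod_type]
    rfl

theorem prod_eq_mul_prod_ne {M : ℕ} (m : Fin M) (F : Fin M → ℂ) :
    ∏ i, F i = F m * ∏ i : {i // i ≠ m}, F i := by
  rw [← Finset.mul_prod_erase _ _ (Finset.mem_univ m)]
  congr 1
  exact Finset.prod_subtype _ (by simp) _

/-- The traces over the discarded halves factorize, leaving each unused register of the receiver in
its marginal state. -/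
theorem ampliate_keepRegister {M : ℕ} {R B : Type} [Fintype B] (σ : Matrix (R × B) (R × B) ℂ)
    (m : Fin M) (r r' : Fin M → R) (b b' : B) :
    ampliate (keepRegister m) (pairPower σ M) (r, b) (r', b') =
      σ (r m, b) (r' m, b') * ∏ i, if i = m then 1 else traceRight σ (r i) (r' i) := by
  have h1 : ∀ t : {i // i ≠ m} → B, pairPower σ M (r, (Equiv.funSplitAt m B).symm (b, t))
      (r', (Equiv.funSplitAt m B).symm (b', t))
      = σ (r m, b) (r' m, b') * ∏ i : {i // i ≠ m}, σ (r i, t i) (r' i, t i) := by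
    intro t
    simp only [pairPower, submatrix_apply, piTensor]
    rw [prod_eq_mul_prod_ne m]
    congr 1
    · simp [Equiv.arrowProdEquivProdArrow]
    · refine Finset.prod_congr rfl fun i _ => ?_
      simp [Equiv.arrowProdEquivProdArrow, i.2]
  have h2 := Finset.prod_univ_sum (fun _ : {i // i ≠ m} => (Finset.univ : Finset B))
    (fun i x => σ (r i, x) (r' i, x))
  rw [Fintype.piFinset_univ] at h2
  refine (Finset.sum_congr rfl fun t _ => h1 t).trans ?_
  rw [← Finset.mul_sum, ← h2, prod_eq_mul_prod_ne m, if_pos rfl, one_mul]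
  congr 1
  refine Finset.prod_congr rfl fun i _ => ?_
  rw [if_neg i.2]
  rfl

end Encoder

/-! ### The position-based code and its error bound. -/

section PositionCode

variable {K : ℕ} {M : Fin K → ℕ} {Q B : Fin K → Type} {D : Type}

theorem partlyIndependent_univ [∀ k, Fintype (Q k)] [∀ k, DecidableEq (Q k)]
    (τ : ∀ k, Matrix (Q k) (Q k) ℂ)
    (W : Matrix ((∀ k, Q k) × D) ((∀ k, Q k) × D) ℂ) :
    partlyIndependent τ W Finset.univ = W := by
  ext ⟨y', d'⟩ ⟨y, d⟩
  rw [partlyIndependent_apply, Finset.sum_eq_single y]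
  · simp
  · intro t _ ht
    obtain ⟨k, hk⟩ := Function.ne_iff.mp ht
    rw [Finset.prod_eq_zero (Finset.mem_univ k), mul_zero]
    simp [hk]
  · simp

theorem partlyIndependent_isState [∀ k, Fintype (Q k)] [Fintype D]
    {τ : ∀ k, Matrix (Q k) (Q k) ℂ} (hτ : ∀ k, IsState (τ k))
    {W : Matrix ((∀ k, Q k) × D) ((∀ k, Q k) × D) ℂ} (hW : IsState W) (L : Finset (Fin K)) :
    IsState (partlyIndependent τ W L) := by
  refine isState_submatrix_equiv ⟨?_, ?_⟩ _
  · exact (piTensor_posSemidef fun k : {k // k ∉ L} => (hτ k).1).kronecker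
      (marginalSC_isState hW L).1
  · rw [trace_kronecker, (marginalSC_isState hW L).2,
      (piTensor_isState fun k : {k // k ∉ L} => hτ k).2, one_mul]

theorem checkOp_smul_one_add [∀ k, DecidableEq (Q k)] [DecidableEq D]
    {T : Matrix ((∀ k, Q k) × D) ((∀ k, Q k) × D) ℂ} (η : ℂ)
    (m : ∀ k, Fin (M k)) : checkOp T m = checkOp (T - η • 1) m + η • 1 := by
  rw [checkOp_sub]
  have : checkOp (η • (1 : Matrix ((∀ k, Q k) × D) ((∀ k, Q k) × D) ℂ)) m = η • 1 := by
    rw [← checkOp_one m]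
    ext p q
    simp only [checkOp, Matrix.smul_apply]
    split_ifs <;> simp
  rw [this, sub_add_cancel]

theorem received_eq_atPositions [∀ k, Fintype (B k)]
    (Φ : Matrix (∀ k, B k) (∀ k, B k) ℂ →ₗ[ℂ] Matrix D D ℂ)
    (σ : ∀ k, Matrix (Q k × B k) (Q k × B k) ℂ) (m : ∀ k, Fin (M k)) :
    ampliate Φ (tensorPairs fun k => ampliate (keepRegister (m k)) (pairPower (σ k) (M k))) =
      atPositions (ampliate Φ (tensorPairs σ)) (fun k => traceRight (σ k)) m := by
  ext ⟨p, d⟩ ⟨q, d'⟩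
  -- The factor from the spectator registers does not depend on the channel input, so linearity
  -- pulls it out of `Φ`.
  have key : ∀ (z : ℂ) (X Y : Matrix (∀ k, B k) (∀ k, B k) ℂ),
      (∀ a a', X a a' = Y a a' * z) → Φ X d d' = Φ Y d d' * z := by
    intro z X Y h
    have : X = z • Y := by
      ext a a'
      rw [h, Matrix.smul_apply, smul_eq_mul, mul_comm]
    rw [this, map_smul, Matrix.smul_apply, smul_eq_mul, mul_comm]
  refine key _ _ _ fun a a' => ?_
  simp only [tensorPairs, ampliate_keepRegister, Finset.prod_mul_distrib]

variable [∀ k, Fintype (Q k)] [∀ k, DecidableEq (Q k)] [∀ k, Fintype (B k)] [Fintype D] [DecidableEq D]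

/-- A test bounded below by `η > 0` gives a sum of full support, so the square-root measurement sums
to the identity without an extra failure outcome. -/
theorem sum_checkOp_posDef (hM : ∀ k, 0 < M k) {T : Matrix ((∀ k, Q k) × D) ((∀ k, Q k) × D) ℂ}
    {η : ℝ} (hη : 0 < η) (hT : (T - (η : ℂ) • 1).PosSemidef) :
    (∑ m : ∀ k, Fin (M k), checkOp T m).PosDef := by
  have : Nonempty (∀ k, Fin (M k)) := ⟨fun k => ⟨0, hM k⟩⟩
  refine Matrix.posDef_sum Finset.univ_nonempty fun m _ => ?_
  rw [checkOp_smul_one_add (η : ℂ) m]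
  exact PosDef.posSemidef_add (checkOp_posSemidef hT m)
    (PosDef.one.smul (Complex.zero_lt_real.mpr hη))

/-- Position-based coding with the square-root measurement of a test `T ≥ η > 0`. -/
theorem exists_positionCode (Φ : Matrix (∀ k, B k) (∀ k, B k) ℂ →ₗ[ℂ] Matrix D D ℂ)
    {σ : ∀ k, Matrix (Q k × B k) (Q k × B k) ℂ} (hσ : ∀ k, IsState (σ k))
    (hW : (ampliate Φ (tensorPairs σ)).PosSemidef) (hM : ∀ k, 0 < M k)
    {T : Matrix ((∀ k, Q k) × D) ((∀ k, Q k) × D) ℂ} {η : ℝ} (hη : 0 < η)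
    (hT : (T - (η : ℂ) • 1).PosSemidef) (hT1 : (1 - T).PosSemidef) :
    ∃ c : EACode M (fun k => Fin (M k) → Q k) (fun k => Fin (M k) → B k) B D,
      c.UsesSimultaneousDecoder ∧ ∀ m, c.errorProb Φ m ≤
        2 * ((1 - T) * ampliate Φ (tensorPairs σ)).trace.re +
        4 * ∑ m' ∈ Finset.univ.erase m, (T * partlyIndependent (fun k => traceRight (σ k))
          (ampliate Φ (tensorPairs σ)) (Finset.univ.filter fun k => m k = m' k)).trace.re := by
  have hS := sum_checkOp_posDef hM hη hT
  have hT0 : T.PosSemidef := by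
    have := hT.add (PosSemidef.one.smul (Complex.zero_le_real.mpr hη.le))
    rwa [sub_add_cancel] at this
  have hΓ : ∀ m : ∀ k, Fin (M k), (checkOp T m).PosSemidef := checkOp_posSemidef hT0
  have hΓ1 : ∀ m : ∀ k, Fin (M k), (1 - checkOp T m).PosSemidef := fun m => by
    rw [← checkOp_one m, ← checkOp_sub]
    exact checkOp_posSemidef hT1 m
  have hτ : ∀ k, IsState (traceRight (σ k)) := fun k => traceRight_isState (hσ k)
  refine ⟨{ shared := fun k => pairPower (σ k) (M k)
            shared_isState := fun k => pairPower_isState (hσ k) (M k)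
            enc := fun k m => keepRegister m
            enc_isChannel := fun k m => keepRegister_isChannel m
            dec := fun m => simultaneousDecoder T m
            dec_posSemidef := squareRootMeasurement_posSemidef hΓ hS
            dec_sum := squareRootMeasurement_sum hS }, ⟨T, hT0, hT1, fun _ => rfl⟩, fun m => ?_⟩
  simp only [EACode.errorProb, EACode.received, received_eq_atPositions]
  refine (squareRootMeasurement_error_le hΓ hΓ1 hS
    (atPositions_posSemidef hW (fun k => (hτ k).1) m) m).trans_eq ?_
  simp only [trace_checkOp_mul_atPositions fun k => (hτ k).2]
  congr 3
  rw [← checkOp_one m, ← checkOp_sub, trace_checkOp_mul_atPositions fun k => (hτ k).2]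
  simp [partlyIndependent_univ]

theorem card_agree_on_eq (m : ∀ k, Fin (M k)) (L : Finset (Fin K)) :
    (Finset.univ.filter fun m' : ∀ k, Fin (M k) =>
      (Finset.univ.filter fun k => m k = m' k) = L).card = ∏ k ∈ Lᶜ, (M k - 1) := by
  have h : (Finset.univ.filter fun m' : ∀ k, Fin (M k) =>
      (Finset.univ.filter fun k => m k = m' k) = L)
      = Fintype.piFinset fun k => if k ∈ L then {m k} else Finset.univ.erase (m k) := by
    ext m'
    simp only [Finset.mem_filter, Finset.mem_univ, true_and, Fintype.mem_piFinset,
      Finset.ext_iff]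
    refine forall_congr' fun k => ?_
    by_cases hk : k ∈ L
    · simp [hk, eq_comm]
    · simp [hk, eq_comm]
  rw [h, Fintype.card_piFinset, ← Finset.prod_mul_prod_compl L, Finset.prod_eq_one, one_mul]
  · refine Finset.prod_congr rfl fun k hk => ?_
    rw [if_neg (Finset.mem_compl.mp hk), Finset.card_erase_of_mem (Finset.mem_univ _)]
    simp
  · intro k hk
    simp [hk]

/-- Group the wrong message tuples by the set of senders whose message is right. -/
theorem sum_wrong_messages_eq (hM : ∀ k, 0 < M k) (m : ∀ k, Fin (M k))
    {g : Finset (Fin K) → ℝ} :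
    ∑ m' ∈ Finset.univ.erase m, g (Finset.univ.filter fun k => m k = m' k) =
      ∑ L ∈ Finset.univ.erase Finset.univ, (∏ k ∈ Lᶜ, ((M k : ℝ) - 1)) * g L := by
  have hmaps : ∀ m' ∈ Finset.univ.erase m, (Finset.univ.filter fun k => m k = m' k) ∈
      (Finset.univ.erase Finset.univ : Finset (Finset (Fin K))) := by
    intro m' hm'
    rw [Finset.mem_erase] at hm' ⊢
    refine ⟨fun h => hm'.1 ?_, Finset.mem_univ _⟩
    funext k
    have : k ∈ Finset.univ.filter fun k => m k = m' k := by
      rw [h]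
      exact Finset.mem_univ k
    exact (Finset.mem_filter.mp this).2.symm
  rw [← Finset.sum_fiberwise_of_maps_to hmaps]
  refine Finset.sum_congr rfl fun L hL => ?_
  have h1 : ∑ m' ∈ (Finset.univ.erase m).filter
      (fun m' => (Finset.univ.filter fun k => m k = m' k) = L),
      g (Finset.univ.filter fun k => m k = m' k) = ∑ m' ∈ (Finset.univ.erase m).filter
      (fun m' => (Finset.univ.filter fun k => m k = m' k) = L), g L :=
    Finset.sum_congr rfl fun m' hm' => by rw [(Finset.mem_filter.mp hm').2]
  have h2 : (Finset.univ.erase m).filter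
      (fun m' => (Finset.univ.filter fun k => m k = m' k) = L) = Finset.univ.filter
      (fun m' => (Finset.univ.filter fun k => m k = m' k) = L) := by
    ext m'
    simp only [Finset.mem_filter, Finset.mem_erase, Finset.mem_univ, and_true, true_and,
      and_iff_right_iff_imp]
    rintro h rfl
    rw [Finset.mem_erase] at hL
    exact hL.1 (by rw [← h]; simp)
  rw [h1, h2, Finset.sum_const, card_agree_on_eq, nsmul_eq_mul, Nat.cast_prod]
  congr 1
  exact Finset.prod_congr rfl fun k _ => by rw [Nat.cast_sub (hM k), Nat.cast_one]

theorem avgError_le_of_forall (hM : ∀ k, 0 < M k)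
    {c : EACode M (fun k => Fin (M k) → Q k) (fun k => Fin (M k) → B k) B D}
    {Φ : Matrix (∀ k, B k) (∀ k, B k) ℂ →ₗ[ℂ] Matrix D D ℂ} {ε : ℝ}
    (h : ∀ m, c.errorProb Φ m ≤ ε) : c.avgError Φ ≤ ε := by
  have hpos : (0 : ℝ) < ∏ k, (M k : ℝ) := Finset.prod_pos fun k _ => Nat.cast_pos.mpr (hM k)
  rw [EACode.avgError, div_le_iff₀ hpos]
  refine (Finset.sum_le_sum fun m _ => h m).trans_eq ?_
  rw [Finset.sum_const, Finset.card_univ, Fintype.card_pi, nsmul_eq_mul, mul_comm]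
  simp

end PositionCode

/-! ### Choice of the test and counting of exponents. -/

section Achievability

/-- The mixture `(1 - η) T + η` supplies the lower bound needed for an invertible sum. It does not
increase misses and adds at most `η` to each false alarm. -/
theorem mixed_test {ι : Type} [Fintype ι] [DecidableEq ι] {T : Matrix ι ι ℂ} (hT : T.PosSemidef)
    (hT1 : (1 - T).PosSemidef) {η : ℝ} (hη : 0 < η) (hη1 : η ≤ 1) :
    ∃ T' : Matrix ι ι ℂ, (T' - (η : ℂ) • 1).PosSemidef ∧ (1 - T').PosSemidef ∧
      (∀ ρ, IsState ρ → ((1 - T') * ρ).trace.re ≤ ((1 - T) * ρ).trace.re) ∧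
      ∀ ρ, IsState ρ → (T' * ρ).trace.re ≤ (T * ρ).trace.re + η := by
  have h1 : (0 : ℂ) ≤ ((1 - η : ℝ) : ℂ) := Complex.zero_le_real.mpr (by linarith)
  have e1 : 1 - (((1 - η : ℝ) : ℂ) • T + (η : ℂ) • 1) = ((1 - η : ℝ) : ℂ) • (1 - T) := by
    push_cast
    module
  refine ⟨((1 - η : ℝ) : ℂ) • T + (η : ℂ) • 1, ?_, ?_, fun ρ hρ => ?_, fun ρ hρ => ?_⟩
  · rw [add_sub_cancel_right]
    exact hT.smul h1
  · rw [e1]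
    exact hT1.smul h1
  · have := trace_mul_re_nonneg hT1 hρ.1
    rw [e1, Matrix.smul_mul, Matrix.trace_smul, smul_eq_mul, Complex.re_ofReal_mul]
    nlinarith
  · have := trace_mul_re_nonneg hT hρ.1
    rw [Matrix.add_mul, Matrix.smul_mul, Matrix.smul_mul, Matrix.one_mul, Matrix.trace_add,
      Matrix.trace_smul, Matrix.trace_smul, hρ.2, Complex.add_re, smul_eq_mul, smul_eq_mul,
      Complex.re_ofReal_mul, Complex.re_ofReal_mul, Complex.one_re]
    nlinarith

theorem trace_kronecker_one_mul {α β : Type} [Fintype α] [Fintype β] [DecidableEq β]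
    (X : Matrix α α ℂ) (W : Matrix (α × β) (α × β) ℂ) :
    ((X ⊗ₖ (1 : Matrix β β ℂ)) * W).trace = (X * traceRight W).trace := by
  simp only [Matrix.trace, Matrix.diag, Matrix.mul_apply, Fintype.sum_prod_type, traceRight,
    kroneckerMap_apply, Matrix.one_apply, Finset.mul_sum]
  refine Finset.sum_congr rfl fun a _ => ?_
  rw [Finset.sum_comm]
  refine Finset.sum_congr rfl fun a' _ => ?_
  refine Finset.sum_congr rfl fun b _ => ?_
  simp

theorem traceRight_pairPower {S A : Type} [Fintype A] (X : Matrix (S × A) (S × A) ℂ) (n : ℕ) :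
    traceRight (pairPower X n) = piTensor fun _ : Fin n => traceRight X := by
  ext s s'
  simp only [traceRight, pairPower, piTensor, submatrix_apply]
  rw [prod_sum_fin]
  rfl

/-- `Q` sees only the product marginal on the references, so the acceptance probability is a product
of `K` factors; Bernoulli's inequality finishes. -/
theorem piTensor_test_ge {K : ℕ} {Q : Fin K → Type} {D : Type} [∀ k, Fintype (Q k)]
    [∀ k, DecidableEq (Q k)] [Fintype D] [DecidableEq D]
    {W : Matrix ((∀ k, Q k) × D) ((∀ k, Q k) × D) ℂ} {V : ∀ k, Matrix (Q k) (Q k) ℂ}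
    {q r : ∀ k, Q k → ℝ} (hV : ∀ k, (V k)ᴴ * V k = 1)
    (hW : traceRight W = piTensor fun k => conjDiag (V k) (r k)) {ε : ℝ} (hε : ε ≤ 1)
    (h : ∀ k, 1 - ε ≤ (conjDiag (V k) (q k) * conjDiag (V k) (r k)).trace.re) :
    1 - K * ε ≤
      (((piTensor fun k => conjDiag (V k) (q k)) ⊗ₖ (1 : Matrix D D ℂ)) * W).trace.re := by
  rw [trace_kronecker_one_mul, hW, piTensor_mul, piTensor_trace]
  simp only [conjDiag_mul (hV _), conjDiag_trace (hV _), Complex.ofReal_re] at h ⊢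
  rw [← Complex.ofReal_prod, Complex.ofReal_re]
  have h1 := one_add_mul_le_pow (a := -ε) (by linarith) K
  calc 1 - K * ε = 1 + K * -ε := by ring
    _ ≤ (1 + -ε) ^ K := h1
    _ = ∏ _k : Fin K, (1 - ε) := by rw [Fin.prod_const, sub_eq_add_neg]
    _ ≤ _ := Finset.prod_le_prod (fun k _ => by linarith) fun k _ => h k

/-- Backing off the rates gains `|J| δ`, and typicality costs `(1 + |J|) δ / 4`. Since `|J| ≥ 1`, at
least `δ / 2` remains. -/
theorem exponent_bound {K : ℕ} {J : Finset (Fin K)} (hJ : J.Nonempty) {rate Hk N : Fin K → ℝ}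
    {H h2 δ : ℝ} (hδ : 0 < δ) (n : ℕ) (hr : ∑ k ∈ J, rate k ≤ h2 - (H - ∑ k ∈ J, Hk k))
    (hN0 : ∀ k, 0 ≤ N k) (hN : ∀ k, N k ≤ (2 : ℝ) ^ ((n : ℝ) * (rate k - δ))) :
    (∏ k ∈ J, N k) * ((2 : ℝ) ^ ((n : ℝ) * (H + δ / 4)) *
      (∏ k ∈ J, (2 : ℝ) ^ (-((n : ℝ) * (Hk k - δ / 4)))) * ((2 : ℝ) ^ (-h2)) ^ n) ≤
      (2 : ℝ) ^ (-((n : ℝ) * (δ / 2))) := by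
  have h1 : ∏ k ∈ J, N k ≤ (2 : ℝ) ^ ∑ k ∈ J, (n : ℝ) * (rate k - δ) := by
    rw [Real.rpow_sum_of_pos two_pos]
    exact Finset.prod_le_prod (fun k _ => hN0 k) fun k _ => hN k
  refine (mul_le_mul_of_nonneg_right h1 (by positivity)).trans ?_
  rw [← Real.rpow_sum_of_pos two_pos, ← Real.rpow_natCast, ← Real.rpow_mul two_pos.le,
    ← Real.rpow_add two_pos, ← Real.rpow_add two_pos, ← Real.rpow_add two_pos]
  refine Real.rpow_le_rpow_of_exponent_le one_le_two ?_
  rw [Finset.sum_neg_distrib, ← Finset.mul_sum, ← Finset.mul_sum, Finset.sum_sub_distrib,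
    Finset.sum_sub_distrib, Finset.sum_const, Finset.sum_const, nsmul_eq_mul, nsmul_eq_mul]
  have hc : (1 : ℝ) ≤ (J.card : ℝ) := by exact_mod_cast hJ.card_pos
  have h3 : ∑ k ∈ J, rate k - J.card * δ + (H + δ / 4) - (∑ k ∈ J, Hk k - J.card * (δ / 4)) - h2
      ≤ -(δ / 2) := by nlinarith
  have h4 := mul_le_mul_of_nonneg_left h3 (Nat.cast_nonneg (α := ℝ) n)
  linarith

theorem eventually_rpow_le {c δ ε : ℝ} (hδ : 0 < δ) (hε : 0 < ε) :
    ∀ᶠ n : ℕ in atTop, c * (2 : ℝ) ^ (-((n : ℝ) * δ)) ≤ ε := by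
  have h1 : (2 : ℝ) ^ (-δ) < 1 := Real.rpow_lt_one_of_one_lt_of_neg one_lt_two (by linarith)
  have h2 := (tendsto_pow_atTop_nhds_zero_of_lt_one (by positivity) h1).const_mul c
  rw [mul_zero] at h2
  filter_upwards [h2.eventually (ge_mem_nhds hε)] with n hn
  rwa [← Real.rpow_natCast, ← Real.rpow_mul two_pos.le, neg_mul, mul_comm δ] at hn

variable {K : ℕ} {A S : Fin K → Type} {C : Type}
  [∀ k, Fintype (A k)] [∀ k, DecidableEq (A k)]
  [∀ k, Fintype (S k)] [∀ k, DecidableEq (S k)] [Fintype C] [DecidableEq C]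

/-- For large `n` there is a test that accepts `ω^{⊗n}` and rarely accepts when some of the senders
are independent of the output. -/
theorem eventually_exists_test {ω : Matrix ((∀ k, S k) × C) ((∀ k, S k) × C) ℂ}
    (hω : IsState ω) {τ : ∀ k, Matrix (S k) (S k) ℂ} (hτ : ∀ k, IsState (τ k))
    (h : traceRight ω = piTensor τ) {δ ε : ℝ} (hδ : 0 < δ) (hε : 0 < ε) (hε1 : ε ≤ 1) :
    ∀ᶠ n : ℕ in atTop, ∃ T : Matrix ((∀ k, Fin n → S k) × (Fin n → C))
        ((∀ k, Fin n → S k) × (Fin n → C)) ℂ, T.PosSemidef ∧ (1 - T).PosSemidef ∧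
      ((1 - T) * blockPower ω n).trace.re ≤ (2 + 4 * K) * ε ∧
      ∀ L : Finset (Fin K), (T * partlyIndependent (fun k => piTensor fun _ : Fin n => τ k)
        (blockPower ω n) L).trace.re ≤ (2 : ℝ) ^ ((n : ℝ) * (entropy ω + δ)) *
          (∏ k ∈ Lᶜ, (2 : ℝ) ^ (-((n : ℝ) * (entropy (τ k) - δ)))) *
          ((2 : ℝ) ^ (-renyiTwo (marginalSC ω L))) ^ n := by
  filter_upwards [eventually_exists_effect_le hω (lt_add_of_pos_right _ hδ) hε,
    eventually_all.2 fun k => eventually_exists_projection_le (hτ k) (sub_lt_self _ hδ) hε]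
    with n h1 h2
  obtain ⟨P', hP', hP1', hPW', hPtr'⟩ := h1
  choose V q r hV hr hr0 hq hqr hqtr using h2
  have hq0 : ∀ k x, 0 ≤ q k x := fun k x => by rcases hq k x with h | h <;> simp [h]
  have hq1 : ∀ k x, q k x ≤ 1 := fun k x => by rcases hq k x with h | h <;> simp [h]
  have hW : IsState (blockPower ω n) := blockPower_isState hω n
  set e := blockEquiv S C n
  set P := P'.submatrix e e with hPdef
  have hP : P.PosSemidef := hP'.submatrix e
  have hP1 : (1 - P).PosSemidef := by
    have := hP1'.submatrix e
    rwa [Matrix.submatrix_sub, Pi.sub_apply, Pi.sub_apply, Matrix.submatrix_one_equiv] at this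
  have hPW : ((((2 : ℝ) ^ ((n : ℝ) * (entropy ω + δ)) : ℝ) : ℂ) • blockPower ω n
      - P).PosSemidef := hPW'.submatrix e
  have hPtr : 1 - ε ≤ (P * blockPower ω n).trace.re := by
    rwa [blockPower, hPdef, Matrix.submatrix_mul_equiv, trace_submatrix_equiv]
  set Qf := (piTensor fun k => conjDiag (V k) (q k)) ⊗ₖ (1 : Matrix (Fin n → C) (Fin n → C) ℂ)
    with hQf
  have hQ : Qf.PosSemidef := (piTensor_conjDiag_posSemidef hq0).kronecker PosSemidef.one
  have hQ1 : (1 - Qf).PosSemidef := posSemidef_one_sub_kronecker_one (by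
    have := conjDiag_piTensor_le hV (c := fun _ => 1) hq0 hq1
    simpa using this)
  have hWtr : traceRight (blockPower ω n) = piTensor fun k => conjDiag (V k) (r k) := by
    rw [traceRight_blockPower h]
    simp only [hr]
  have hQtr : 1 - K * ε ≤ (Qf * blockPower ω n).trace.re :=
    piTensor_test_ge hV hWtr hε1 fun k => by
      have := hqtr k
      rwa [hr k] at this
  have hone : ∀ X : Matrix ((∀ k, Fin n → S k) × (Fin n → C))
        ((∀ k, Fin n → S k) × (Fin n → C)) ℂ, ((1 - X) * blockPower ω n).trace.re
        = 1 - (X * blockPower ω n).trace.re := fun X => by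
    rw [Matrix.sub_mul, Matrix.one_mul, Matrix.trace_sub, hW.2, Complex.sub_re, Complex.one_re]
  -- `Q` stands outside so that, under the trace, it acts on the independent states. The miss bound
  -- is `2 ε` from `P` plus `4 K ε` from `Q`.
  refine ⟨Qf * P * Qf, ?_, posSemidef_sandwich_one hP1 hQ hQ1, ?_, fun L => ?_⟩
  · have := hP.mul_mul_conjTranspose_same Qf
    rwa [hQ.isHermitian.eq] at this
  · refine (trace_mul_re_mono (posSemidef_sandwich hP hP1 hQ hQ1) hW.1).trans ?_
    rw [Matrix.add_mul, Matrix.smul_mul, Matrix.smul_mul, Matrix.trace_add, Matrix.trace_smul,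
      Matrix.trace_smul, Complex.add_re]
    have e1 : ((2 : ℂ) • ((1 - P) * blockPower ω n).trace).re
        = 2 * (1 - (P * blockPower ω n).trace.re) := by rw [← hone]; simp
    have e2 : ((4 : ℂ) • ((1 - Qf) * blockPower ω n).trace).re
        = 4 * (1 - (Qf * blockPower ω n).trace.re) := by rw [← hone]; simp
    rw [e1, e2]
    linarith
  · have hpos := (marginalSC_isState hω L).trace_sq_pos
    have key := test_bound (P := P) (c := (2 : ℝ) ^ ((n : ℝ) * (entropy ω + δ)))
      (c' := fun k => (2 : ℝ) ^ (-((n : ℝ) * (entropy (τ k) - δ)))) (by positivity) hW.1 hPW hV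
      hr0 hq hqr (fun k => by positivity) L
    simp only [← hr] at key
    refine key.trans_eq ?_
    rw [marginalSC_blockPower, blockPower_trace_sq]
    congr 1
    have him : (marginalSC ω L * marginalSC ω L).trace
        = (((marginalSC ω L * marginalSC ω L).trace.re : ℝ) : ℂ) := by
      refine Complex.ext rfl ?_
      have := (Matrix.posSemidef_conjTranspose_mul_self (marginalSC ω L)).trace_nonneg
      rw [(marginalSC_isState hω L).1.isHermitian.eq] at this
      exact (Complex.le_def.mp this).2.symm
    rw [him, ← Complex.ofReal_pow, Complex.ofReal_re, renyiTwo, neg_neg,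
      Real.rpow_logb two_pos (by norm_num) hpos]

end Achievability

end

end QMAC

/-! ### The achievability theorem. -/

theorem mainTheorem4 {K : ℕ} {A S : Fin K → Type} {C : Type}
    [∀ k, Fintype (A k)] [∀ k, DecidableEq (A k)]
    [∀ k, Fintype (S k)] [∀ k, DecidableEq (S k)] [Fintype C] [DecidableEq C]
    (N : Matrix (∀ k, A k) (∀ k, A k) ℂ →ₗ[ℂ] Matrix C C ℂ) (hN : QMAC.IsChannel N)
    (θ : ∀ k, Matrix (S k × A k) (S k × A k) ℂ) (hθ : ∀ k, QMAC.IsState (θ k))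
    (rate : Fin K → ℝ)
    (hrate : ∀ J : Finset (Fin K), J.Nonempty →
      ∑ j ∈ J, rate j ≤ QMAC.rateBound (QMAC.ampliate N (QMAC.tensorPairs θ)) J) :
    QMAC.AchievableSimultaneously N rate := by
  open QMAC in
  intro ε hε hε1 δ hδ
  have hK : (0 : ℝ) ≤ K := Nat.cast_nonneg K
  set ω := ampliate N (tensorPairs θ) with hωdef
  have hω : IsState ω := hN.ampliate_isState (tensorPairs_isState hθ)
  have hτ : ∀ k, IsState (traceRight (θ k)) := fun k => traceRight_isState (hθ k)
  have hmarg : traceRight ω = piTensor fun k => traceRight (θ k) := traceRight_ampliate hN θ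
  -- Chosen so that `2 (2 + 4K) ε₀ + 4 (ε/8 + ε₀) = 8 (K + 1) ε₀ + ε/2 = ε`.
  set ε₀ := ε / (16 * (K + 1)) with hε₀
  have hε₀pos : 0 < ε₀ := by positivity
  have hε₀1 : ε₀ ≤ 1 := by
    rw [hε₀, div_le_one (by positivity)]
    linarith
  have hε₀K : 8 * (K + 1) * ε₀ = ε / 2 := by
    rw [hε₀]
    field_simp
    norm_num
  have hent : ∀ J : Finset (Fin K), J.Nonempty → ∑ j ∈ J, rate j ≤
      renyiTwo (marginalSC ω Jᶜ) - (entropy ω - ∑ j ∈ J, entropy (traceRight (θ j))) := by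
    intro J hJ
    refine (hrate J hJ).trans_eq ?_
    rw [rateBound, condEntropy, marginalS_eq_piTensor hmarg (fun k => (hτ k).2),
      entropy_piTensor fun k : {k // k ∈ J} => hτ k]
    rw [← Finset.sum_coe_sort J]
  -- The constant `2 ^ K` counts the possible sets of correctly guessed senders.
  obtain ⟨n₀, hn₀⟩ := Filter.eventually_atTop.mp
    ((eventually_exists_test hω hτ hmarg (δ := δ / 4) (by positivity) hε₀pos hε₀1).and
      (eventually_rpow_le (c := 2 ^ K) (δ := δ / 2) (ε := ε / 8) (by positivity)
        (by positivity)))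
  refine ⟨n₀, fun n hn => ?_⟩
  obtain ⟨⟨T, hT, hT1, hTω, hTL⟩, hexp⟩ := hn₀ n hn
  set M : Fin K → ℕ := fun k => ⌈(2 : ℝ) ^ ((n : ℝ) * (rate k - δ))⌉₊ with hMdef
  have hM : ∀ k, 0 < M k := fun k => Nat.ceil_pos.mpr (by positivity)
  have hM1 : ∀ k, (1 : ℝ) ≤ M k := fun k => by exact_mod_cast hM k
  have hprod1 : (1 : ℝ) ≤ ∏ k, (M k : ℝ) := Finset.one_le_prod fun k _ => hM1 k
  -- There are fewer than `∏ M k` wrong tuples, so the admixture costs at most `ε₀` in total.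
  set η := ε₀ / ∏ k, (M k : ℝ) with hηdef
  have hη : 0 < η := by positivity
  have hη1 : η ≤ 1 := (div_le_self hε₀pos.le hprod1).trans hε₀1
  obtain ⟨T', hT'η, hT'1, hT'miss, hT'false⟩ := mixed_test hT hT1 hη hη1
  have hW : ampliate (tensorPower N n) (tensorPairs fun k => pairPower (θ k) n) = blockPower ω n :=
    ampliate_tensorPower N θ n
  have hWs : IsState (blockPower ω n) := blockPower_isState hω n
  obtain ⟨c, hc, herr⟩ := exists_positionCode (M := M) (tensorPower N n)
    (fun k => pairPower_isState (hθ k) n) (hW ▸ hWs.1) hM hη hT'η hT'1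
  refine ⟨M, fun _ => rfl, fun k => Fin n → S k, _, inferInstance, inferInstance, inferInstance,
    c, hc, avgError_le_of_forall hM fun m => (herr m).trans ?_⟩
  rw [hW]
  simp only [traceRight_pairPower]
  have hτn : ∀ k, IsState (piTensor fun _ : Fin n => traceRight (θ k)) := fun k =>
    piTensor_isState fun _ => hτ k
  have hmiss := (hT'miss _ hWs).trans hTω
  have hfalse : ∑ m' ∈ Finset.univ.erase m, (T' * partlyIndependent
      (fun k => piTensor fun _ : Fin n => traceRight (θ k)) (blockPower ω n)
      (Finset.univ.filter fun k => m k = m' k)).trace.re ≤ ε / 8 + ε₀ := by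
    calc _ ≤ ∑ m' ∈ Finset.univ.erase m, ((T * partlyIndependent
          (fun k => piTensor fun _ : Fin n => traceRight (θ k)) (blockPower ω n)
          (Finset.univ.filter fun k => m k = m' k)).trace.re + η) :=
          Finset.sum_le_sum fun m' _ => hT'false _ (partlyIndependent_isState hτn hWs _)
      _ ≤ ε / 8 + ε₀ := by
        rw [Finset.sum_add_distrib]
        refine add_le_add ?_ ?_
        · rw [sum_wrong_messages_eq hM m (g := fun L => (T * partlyIndependent
            (fun k => piTensor fun _ : Fin n => traceRight (θ k)) (blockPower ω n) L).trace.re)]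
          have hterm : ∀ L ∈ (Finset.univ.erase Finset.univ : Finset (Finset (Fin K))),
              (∏ k ∈ Lᶜ, ((M k : ℝ) - 1)) * (T * partlyIndependent
                (fun k => piTensor fun _ : Fin n => traceRight (θ k))
                (blockPower ω n) L).trace.re ≤ (2 : ℝ) ^ (-((n : ℝ) * (δ / 2))) := by
            intro L hL
            have hJ : (Lᶜ).Nonempty := by
              rw [Finset.nonempty_iff_ne_empty, Ne, Finset.compl_eq_empty_iff]
              exact Finset.ne_of_mem_erase hL
            have hr := hent Lᶜ hJ
            rw [compl_compl] at hr
            refine (mul_le_mul_of_nonneg_left (hTL L)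
              (Finset.prod_nonneg fun k _ => sub_nonneg.mpr (hM1 k))).trans ?_
            -- Each wrong sender has `M k - 1` alternatives, which the ceiling keeps below
            -- `2^{n(rate k - δ)}` exactly, even when that power is less than `1`.
            exact exponent_bound hJ hδ n hr (fun k => sub_nonneg.mpr (hM1 k)) fun k =>
              (sub_lt_iff_lt_add.mpr (Nat.ceil_lt_add_one (by positivity))).le
          refine (Finset.sum_le_sum hterm).trans (le_trans ?_ hexp)
          rw [Finset.sum_const, nsmul_eq_mul]
          refine mul_le_mul_of_nonneg_right ?_ (by positivity)
          have : (Finset.univ.erase Finset.univ : Finset (Finset (Fin K))).card ≤ 2 ^ K := by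
            refine (Finset.card_erase_le).trans ?_
            simp
          exact_mod_cast this
        · rw [Finset.sum_const, nsmul_eq_mul]
          have hcard : (((Finset.univ.erase m).card : ℕ) : ℝ) ≤ ∏ k, (M k : ℝ) := by
            have : (Finset.univ.erase m).card ≤ ∏ k, M k := by
              refine (Finset.card_erase_le).trans ?_
              simp
            exact_mod_cast this
          refine (mul_le_mul_of_nonneg_right hcard hη.le).trans_eq ?_
          rw [hηdef]
          field_simp
  nlinarith
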